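/- Let $E$ be a finite-dimensional real Euclidean space, $\mathfrak h=\mathbb C\otimes_{\mathbb R}E$ its complexification, and $W\subset O(E)$ a finite group generated by reflections. Let $S\subset W$ be the set of all reflections in $W$. For each $s\in S$ let $\alpha_s\in\mathfrak h^*$ be a root of $s$ (a nonzero real linear function vanishing on the hyperplane of $s$) and $\alpha_s^\vee\in\mathfrak h$ the corresponding coroot, and let $c:S\to\mathbb C$, $s\mapsto c_s$, be a function invariant under conjugation by $W$. Let $H_c$ be the rational Cherednik algebra, i.e. the unital associative $\mathbb C$-algebra generated by the vector spaces $\mathfrak h$, $\mathfrak h^*$ and the group $W$, with defining relations $$w x w^{-1}=w(x),\quad w y w^{-1}=w(y),\quad x_1x_2=x_2x_1,\quad y_1y_2=y_2y_1,$$ $$yx-xy=\langle y,x\rangle+\sum_{s\in S}c_s\,\langle y,\alpha_s\rangle\langle\alpha_s^\vee,x\rangle\, s$$ for all $x,x_1,x_2\in\mathfrak h^*$, $y,y_1,y_2\in\mathfrak h$, $w\in W$. Regard $\mathbb C[\mathfrak h]$ and $\mathbb C[\mathfrak h^*]$ as the subalgebras of $H_c$ generated by $\mathfrak h^*$ and by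 $\mathfrak h$, respectively, and let $A^-=\mathbb C^{>0}[\mathfrak h^*]^W$ be the algebra of $W$-invariant polynomials on $\mathfrak h^*$ without constant term. Then: (i) Let $M$ be a finitely generated left $H_c$-module on which the action of $A^-$ is locally finite, i.e. every element of $M$ lies in a finite-dimensional $A^-$-stable subspace (an object of the category $\mathcal O(H_c)$). Then $M$ has finite length as an $H_c$-module. (ii) Let $M$ be a Harish-Chandra $H_c$-bimodule, i.e. a finitely generated $H_c\otimes_{\mathbb C} H_c^{\mathrm{op}}$-module such that, for every $a\in\mathbb C[\mathfrak h]^W$ and every $a\in\mathbb C[\mathfrak h^*]^W$, the operator $m\mapsto am-ma$ on $M$ is locally nilpotent. Then $M$ has finite length as an $H_c\otimes_{\mathbb C} H_c^{\mathrm{op}}$-module. -/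

import Mathlib

open scoped TensorProduct

noncomputable section

namespace RationalCherednik

variable {E : Type*} [NormedAddCommGroup E] [InnerProductSpace ℝ E]

/-- The complexification `𝔥 = ℂ ⊗ E` of the real Euclidean space `E`. -/
abbrev Cplx (E : Type*) [NormedAddCommGroup E] [InnerProductSpace ℝ E] : Type _ := ℂ ⊗[ℝ] E

/-- The dual space `𝔥*`. -/
abbrev CplxDual (E : Type*) [NormedAddCommGroup E] [InnerProductSpace ℝ E] : Type _ :=
  Module.Dual ℂ (Cplx E)

/-- The set `S` of all elements of `W` that are orthogonal reflections in a hyperplane of `E`. -/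
def reflections (W : Subgroup (E ≃ₗᵢ[ℝ] E)) : Set W :=
  {w | ∃ v : E, v ≠ 0 ∧ (w : E ≃ₗᵢ[ℝ] E) = (ℝ ∙ v)ᗮ.reflection}

/-- `W` is a finite Coxeter group in `E`: finite and generated by its reflections. -/
structure IsFiniteCoxeter (W : Subgroup (E ≃ₗᵢ[ℝ] E)) : Prop where
  finite : Finite W
  generated : Subgroup.closure (reflections W) = ⊤

/-- A choice of roots: to every reflection `s` a nonzero vector `α s` orthogonal to the hyperplane
of `s` (identified, through the inner product, with a linear function vanishing on it). -/
structure IsRootChoice (W : Subgroup (E ≃ₗᵢ[ℝ] E)) (α : reflections W → E) : Prop where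
  ne_zero : ∀ s, α s ≠ 0
  reflection_eq : ∀ s : reflections W, ((s : W) : E ≃ₗᵢ[ℝ] E) = (ℝ ∙ α s)ᗮ.reflection

/-- `c : S → ℂ` is invariant under conjugation by `W`. -/
def IsInvariantParameter (W : Subgroup (E ≃ₗᵢ[ℝ] E)) (c : reflections W → ℂ) : Prop :=
  ∀ (w : W) (s t : reflections W), (t : W) = w * s * w⁻¹ → c t = c s

/-- The complex-linear action of an isometry `w` of `E` on `𝔥`. -/
def act (w : E ≃ₗᵢ[ℝ] E) : Cplx E →ₗ[ℂ] Cplx E :=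
  LinearMap.baseChange ℂ (w.toLinearEquiv : E →ₗ[ℝ] E)

/-- The contragredient action on `𝔥*`: `(w x)(y) = x (w⁻¹ y)`. -/
def actDual (w : E ≃ₗᵢ[ℝ] E) (x : CplxDual E) : CplxDual E := x ∘ₗ act w⁻¹

/-- The complex-linear extension to `𝔥` of the linear function `(v, -)` on `E`. -/
def rootForm (v : E) : CplxDual E := Module.Dual.baseChange ℂ (innerₗ E v)

/-- The coroot `2 v / (v, v)`, as an element of `𝔥`. -/
def coroot (v : E) : Cplx E := (1 : ℂ) ⊗ₜ[ℝ] ((2 / inner ℝ v v : ℝ) • v)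

/-- The generators of the rational Cherednik algebra: the elements of `𝔥`, `𝔥*` and `W`. -/
inductive Gen (W : Subgroup (E ≃ₗᵢ[ℝ] E)) : Type _
  | y : Cplx E → Gen W
  | x : CplxDual E → Gen W
  | w : W → Gen W

variable (W : Subgroup (E ≃ₗᵢ[ℝ] E)) (α : reflections W → E) (c : reflections W → ℂ)

/-- A generator in the free algebra. -/
def gen (g : Gen W) : FreeAlgebra ℂ (Gen W) := FreeAlgebra.ι ℂ g

/-- The defining relations of `H_c`. The first six say that `𝔥` and `𝔥*` enter as vector spaces and
`W` as a group; the others are the commutation relations. -/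
inductive Rel : FreeAlgebra ℂ (Gen W) → FreeAlgebra ℂ (Gen W) → Prop
  | y_add (y₁ y₂ : Cplx E) : Rel (gen W (.y (y₁ + y₂))) (gen W (.y y₁) + gen W (.y y₂))
  | y_smul (a : ℂ) (y : Cplx E) : Rel (gen W (.y (a • y))) (a • gen W (.y y))
  | x_add (x₁ x₂ : CplxDual E) : Rel (gen W (.x (x₁ + x₂))) (gen W (.x x₁) + gen W (.x x₂))
  | x_smul (a : ℂ) (x : CplxDual E) : Rel (gen W (.x (a • x))) (a • gen W (.x x))
  | w_one : Rel (gen W (.w 1)) 1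
  | w_mul (w₁ w₂ : W) : Rel (gen W (.w (w₁ * w₂))) (gen W (.w w₁) * gen W (.w w₂))
  | w_x (w : W) (x : CplxDual E) :
      Rel (gen W (.w w) * gen W (.x x) * gen W (.w w⁻¹)) (gen W (.x (actDual w x)))
  | w_y (w : W) (y : Cplx E) :
      Rel (gen W (.w w) * gen W (.y y) * gen W (.w w⁻¹)) (gen W (.y (act w y)))
  | x_comm (x₁ x₂ : CplxDual E) :
      Rel (gen W (.x x₁) * gen W (.x x₂)) (gen W (.x x₂) * gen W (.x x₁))
  | y_comm (y₁ y₂ : Cplx E) :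
      Rel (gen W (.y y₁) * gen W (.y y₂)) (gen W (.y y₂) * gen W (.y y₁))
  | y_x (y : Cplx E) (x : CplxDual E) :
      Rel (gen W (.y y) * gen W (.x x) - gen W (.x x) * gen W (.y y))
        (algebraMap ℂ _ (x y) +
          ∑ᶠ s : reflections W, (c s * rootForm (α s) y * x (coroot (α s))) • gen W (.w s))

/-- The rational Cherednik algebra `H_c` (at `t = 1`). -/
def Cherednik : Type _ := RingQuot (Rel W α c)

instance : Ring (Cherednik W α c) := inferInstanceAs (Ring (RingQuot (Rel W α c)))

instance : Algebra ℂ (Cherednik W α c) := inferInstanceAs (Algebra ℂ (RingQuot (Rel W α c)))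

/-- The image of a generator in `H_c`. -/
def of (g : Gen W) : Cherednik W α c := RingQuot.mkAlgHom ℂ (Rel W α c) (gen W g)

/-- The image of `𝔥*` in `H_c`. -/
def xSet : Set (Cherednik W α c) := Set.range fun x => of W α c (.x x)

/-- The image of `𝔥` in `H_c`. -/
def ySet : Set (Cherednik W α c) := Set.range fun y => of W α c (.y y)

/-- The image of `W` in `H_c`. -/
def wSet : Set (Cherednik W α c) := Set.range fun w => of W α c (.w w)

/-- `ℂ[𝔥]^W` inside `H_c`: the subalgebra generated by `𝔥*` is `ℂ[𝔥]`, on which `W` acts by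
conjugation, so that its invariants are the elements commuting with `W`. -/
def invX : Subalgebra ℂ (Cherednik W α c) :=
  Algebra.adjoin ℂ (xSet W α c) ⊓ Subalgebra.centralizer ℂ (wSet W α c)

/-- `ℂ[𝔥*]^W` inside `H_c`. -/
def invY : Subalgebra ℂ (Cherednik W α c) :=
  Algebra.adjoin ℂ (ySet W α c) ⊓ Subalgebra.centralizer ℂ (wSet W α c)

/-- `A⁻`, the `W`-invariants without constant term in `ℂ[𝔥*]`, inside `H_c`: the non-unital
subalgebra generated by `𝔥` consists of the polynomials without constant term. -/
def Aminus : NonUnitalSubalgebra ℂ (Cherednik W α c) :=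
  NonUnitalAlgebra.adjoin ℂ (ySet W α c) ⊓ NonUnitalSubalgebra.centralizer ℂ (wSet W α c)

/-- The objects of the category `O(H_c)`: finitely generated left `H_c`-modules on which the action
of `A⁻` is locally finite, i.e. every element lies in a finite-dimensional `A⁻`-stable subspace. -/
structure IsCategoryO (M : Type*) [AddCommGroup M] [Module ℂ M] [Module (Cherednik W α c) M]
    [IsScalarTower ℂ (Cherednik W α c) M] : Prop where
  finite : Module.Finite (Cherednik W α c) M
  locallyFinite : ∀ m : M, ∃ N : Submodule ℂ M, FiniteDimensional ℂ N ∧ m ∈ N ∧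
    ∀ a ∈ Aminus W α c, ∀ n ∈ N, a • n ∈ N

/-- The enveloping algebra `H_c ⊗ H_c^op`; its left modules are the `H_c`-bimodules. -/
abbrev Env : Type _ := Cherednik W α c ⊗[ℂ] (Cherednik W α c)ᵐᵒᵖ

/-- The element `a ⊗ 1 - 1 ⊗ a`, which acts on a bimodule by `m ↦ a m - m a`. -/
def adElt (a : Cherednik W α c) : Env W α c := a ⊗ₜ[ℂ] 1 - 1 ⊗ₜ[ℂ] MulOpposite.op a

/-- Harish-Chandra bimodules: finitely generated `H_c`-bimodules on which `ad a` is locally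
nilpotent for every `a` in `ℂ[𝔥]^W` and every `a` in `ℂ[𝔥*]^W`. -/
structure IsHarishChandra (M : Type*) [AddCommGroup M] [Module (Env W α c) M] : Prop where
  finite : Module.Finite (Env W α c) M
  ad_nilpotent_x : ∀ a ∈ invX W α c, ∀ m : M, ∃ n : ℕ, adElt W α c a ^ n • m = 0
  ad_nilpotent_y : ∀ a ∈ invY W α c, ∀ m : M, ∃ n : ℕ, adElt W α c a ^ n • m = 0

end RationalCherednik

end

/-!
Let `M` be an `H_c`-module that is finitely generated over the coordinate ring `ℂ[𝔥]`. It is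
Noetherian, and the point is that descending chains of submodules stop as well. An equivariant
polynomial vector field `δ` sends `α_s` to a multiple of `α_s`, so that replacing `∂_i` by `y_i` and
correcting by reflections lifts it to an element of `H_c` whose commutator with `ℂ[𝔥]` is `δ`.

Let `J` be the ideal of a `W`-orbit, and choose `δ` to be of Euler type along this orbit. Its lift
acts on `J ^ k M / J ^ (k + 1) M` with the eigenvalues of its action on `M / J M` shifted by `k`,
and those on `N / J N` lie in a finite set that does not depend on the submodule `N`. Together
with the Artin–Rees lemma this yields `J ^ k M ∩ N ⊆ J N` with `k` independent of `N`. On the other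
hand, the annihilator of `N / N'` is stable under all equivariant vector fields, so that the support
of `N / N'` contains with a point every point with the same or a larger stabilizer. Hence a strict
inclusion of submodules is seen in `M / J ^ k M` for the orbit of one point out of each of the
finitely many stabilizer classes, and these quotients are Artinian.

(i) `H_c` is the product of `ℂ[𝔥]`, `ℂ[W]` and `ℂ[𝔥*]`, and `ℂ[𝔥*]` is finite over its
invariants. Hence a module in the category `𝒪` is finitely generated over `ℂ[𝔥]`.

(ii) `H_c ⊗ H_cᵒᵖ` satisfies relations of the same kind for the group `W × W`, with coordinates and
momenta exchanged in the second factor. Since the operators `m ↦ a m - m a` are locally nilpotent,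
right multiplication by the invariants in `ℂ[𝔥]` can be traded for left multiplication, and left
multiplication by those in `ℂ[𝔥*]` for right multiplication. Hence a Harish-Chandra bimodule is
finitely generated over the left action of `ℂ[𝔥]` and the right action of `ℂ[𝔥*]`.
-/

noncomputable section

namespace RationalCherednik

open MvPolynomial
open Subalgebra (toSubmodule)

/-! ### Euler derivations -/

section Derivation

theorem derivation_sum_apply {κ k R M : Type*} [CommSemiring k] [CommSemiring R] [Algebra k R]
    [AddCommMonoid M] [Module k M] [Module R M] (t : Finset κ) (δ : κ → Derivation k R M) (p : R) :
    (∑ j ∈ t, δ j) p = ∑ j ∈ t, δ j p := by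
  rw [← Derivation.coeFnAddMonoidHom_apply, map_sum, Finset.sum_apply]
  rfl

theorem derivation_mem_of_X {ι k M : Type*} [CommRing k] [AddCommGroup M] [Module k M]
    [Module (MvPolynomial ι k) M] {δ : Derivation k (MvPolynomial ι k) M}
    {N : Submodule (MvPolynomial ι k) M} (h : ∀ i, δ (X i) ∈ N) (p : MvPolynomial ι k) :
    δ p ∈ N := by
  induction p using MvPolynomial.induction_on with
  | C a => simp [derivation_C]
  | add p q hp hq => rw [map_add]; exact add_mem hp hq
  | mul_X p i hp =>
    rw [Derivation.leibniz]
    exact add_mem (N.smul_mem _ (h i)) (N.smul_mem _ hp)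

theorem mul_mem_mul_sup {R : Type*} [CommRing R] {I J 𝔭 : Ideal R} {a b : R} (ha : a ∈ I)
    (hb : b ∈ J ⊔ 𝔭) : a * b ∈ I * J ⊔ 𝔭 := by
  have h := Ideal.mul_mem_mul ha hb
  rw [Ideal.mul_sup] at h
  exact sup_le_sup le_rfl (Ideal.mul_le_right (I := I) (J := 𝔭)) h

variable {k R : Type*} [CommRing k] [CommRing R] [Algebra k R]

/-- A derivation which behaves like the Euler vector field along the subscheme defined by `J`: it
vanishes there and is the identity on the conormal module `J / J ^ 2`. Both conditions are taken
modulo a second ideal `𝔭`; for `𝔭 = ⊥` they hold in `R` itself. -/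
structure IsEuler (δ : Derivation k R R) (J 𝔭 : Ideal R) : Prop where
  apply_mem : ∀ p, δ p ∈ J ⊔ 𝔭
  apply_sub_mem : ∀ p ∈ J, δ p - p ∈ J ^ 2 ⊔ 𝔭

variable {δ : Derivation k R R} {J 𝔭 : Ideal R}

theorem isEuler_bot_iff :
    IsEuler δ J ⊥ ↔ (∀ p, δ p ∈ J) ∧ ∀ p ∈ J, δ p - p ∈ J ^ 2 := by
  refine ⟨fun h => ⟨?_, ?_⟩, fun h => ⟨?_, ?_⟩⟩
  · simpa only [sup_bot_eq] using h.apply_mem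
  · simpa only [sup_bot_eq] using h.apply_sub_mem
  · simpa only [sup_bot_eq] using h.1
  · simpa only [sup_bot_eq] using h.2

theorem isEuler_span {s : Set R} (h : ∀ p, δ p ∈ Ideal.span s ⊔ 𝔭)
    (hs : ∀ p ∈ s, δ p - p ∈ Ideal.span s ^ 2 ⊔ 𝔭) : IsEuler δ (Ideal.span s) 𝔭 := by
  refine ⟨h, fun p hp => ?_⟩
  induction hp using Submodule.span_induction with
  | mem p hp => exact hs p hp
  | zero => simp
  | add p q _ _ hp hq =>
    rw [map_add, add_sub_add_comm]
    exact add_mem hp hq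
  | smul r p hp ih =>
    have leibniz : δ (r • p) - r • p = p * δ r + r * (δ p - p) := by
      simp only [smul_eq_mul, Derivation.leibniz]; ring
    rw [leibniz, pow_two]
    rw [pow_two] at ih
    exact add_mem (mul_mem_mul_sup hp (h r)) (Ideal.mul_mem_left _ _ ih)

theorem IsEuler.apply_sub_natCast_mul_mem (hδ : IsEuler δ J 𝔭) (n : ℕ) :
    ∀ p ∈ J ^ n, δ p - n * p ∈ J ^ (n + 1) ⊔ 𝔭 := by
  induction n with
  | zero => intro p _; simpa using hδ.apply_mem p
  | succ n ih =>
    intro p hp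
    rw [pow_succ] at hp
    induction hp using Submodule.mul_induction_on' with
    | mem_mul_mem a ha b hb =>
      have leibniz : δ (a * b) - ((n + 1 : ℕ) : R) * (a * b) =
          a * (δ b - b) + b * (δ a - (n : R) * a) := by
        rw [Derivation.leibniz, smul_eq_mul, smul_eq_mul]; push_cast; ring
      rw [leibniz]
      refine add_mem ?_ ?_
      · rw [add_assoc, one_add_one_eq_two, pow_add]
        exact mul_mem_mul_sup ha (hδ.apply_sub_mem b hb)
      · rw [pow_succ' J (n + 1)]
        exact mul_mem_mul_sup hb (ih a ha)
    | add a _ b _ ha hb =>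
      rw [map_add, mul_add, add_sub_add_comm]
      exact add_mem ha hb

end Derivation

section EulerCharZero

variable {𝕜 R : Type*} [Field 𝕜] [CharZero 𝕜] [CommRing R] [Algebra 𝕜 R] {J 𝔭 : Ideal R}

theorem IsEuler.average {κ : Type*} [Fintype κ] [Nonempty κ] {δ : κ → Derivation 𝕜 R R}
    (hδ : ∀ j, IsEuler (δ j) J 𝔭) : IsEuler ((Fintype.card κ : 𝕜)⁻¹ • ∑ j, δ j) J 𝔭 := by
  refine ⟨fun p => ?_, fun p hp => ?_⟩
  · rw [Derivation.smul_apply, derivation_sum_apply]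
    exact Submodule.smul_of_tower_mem _ _ (sum_mem fun j _ => (hδ j).apply_mem p)
  · have hp_avg : p = (Fintype.card κ : 𝕜)⁻¹ • ∑ _j : κ, p := by
      rw [Finset.sum_const, Finset.card_univ, ← Nat.cast_smul_eq_nsmul 𝕜, smul_smul,
        inv_mul_cancel₀ (Nat.cast_ne_zero.2 Fintype.card_ne_zero), one_smul]
    rw [Derivation.smul_apply, derivation_sum_apply]
    nth_rw 2 [hp_avg]
    rw [← smul_sub, ← Finset.sum_sub_distrib]
    exact Submodule.smul_of_tower_mem _ _ (sum_mem fun j _ => (hδ j).apply_sub_mem p hp)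

/-- An Euler derivation acts on `(J ^ n + 𝔭) / (J ^ (n + 1) + 𝔭)` as multiplication by `n`, which is
invertible: so an ideal on which it raises the order of vanishing vanishes to infinite order. -/
theorem IsEuler.le_pow_sup {δ : Derivation 𝕜 R R} (hδ : IsEuler δ J 𝔭) (h𝔭 : ∀ p ∈ 𝔭, δ p ∈ 𝔭)
    {I : Ideal R} (hI : I ≤ J ⊔ 𝔭)
    (hstep : ∀ n, I ≤ J ^ n ⊔ 𝔭 → ∀ p ∈ I, δ p ∈ J ^ (n + 1) ⊔ 𝔭) (n : ℕ) :
    I ≤ J ^ n ⊔ 𝔭 := by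
  induction n with
  | zero => simp
  | succ n ih =>
    intro p hp
    obtain rfl | hn := eq_or_ne n 0
    · simpa using hI hp
    obtain ⟨a, ha, v, hv, rfl⟩ := Submodule.mem_sup.1 (ih hp)
    have hδa : δ a ∈ J ^ (n + 1) ⊔ 𝔭 := by
      have := sub_mem (hstep n ih _ hp) (Ideal.mem_sup_right (h𝔭 v hv))
      rwa [map_add, add_sub_cancel_right] at this
    have hna : (n : R) * a ∈ J ^ (n + 1) ⊔ 𝔭 := by
      simpa using sub_mem hδa (hδ.apply_sub_natCast_mul_mem n a ha)
    have hunit : IsUnit (n : R) := by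
      simpa using (Nat.cast_ne_zero.2 hn : (n : 𝕜) ≠ 0).isUnit.map (algebraMap 𝕜 R)
    exact add_mem ((Ideal.unit_mul_mem_iff_mem _ hunit).1 hna) (Ideal.mem_sup_right hv)

end EulerCharZero

/-! ### Points and vector fields -/

section Points

variable {𝕜 ι : Type*} [Field 𝕜]

/-- The maximal ideal of the polynomials vanishing at a point. -/
abbrev pointIdeal (b : ι → 𝕜) : Ideal (MvPolynomial ι 𝕜) := vanishingIdeal 𝕜 {b}

/-- Polynomial vector fields on the affine space with coordinates indexed by `ι`, encoded as
derivations of the polynomial algebra. -/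
abbrev VectorField (𝕜 ι : Type*) [Field 𝕜] : Type _ :=
  Derivation 𝕜 (MvPolynomial ι 𝕜) (MvPolynomial ι 𝕜)

theorem X_sub_C_mem_pointIdeal (b : ι → 𝕜) (i : ι) : X i - C (b i) ∈ pointIdeal b := by
  simp

theorem pointIdeal_eq_span (b : ι → 𝕜) :
    pointIdeal b = Ideal.span (Set.range fun i => X i - C (b i)) := by
  refine le_antisymm (fun p hp => ?_) (Ideal.span_le.2 ?_)
  · have taylor : ∀ q : MvPolynomial ι 𝕜,
        q - C (aeval b q) ∈ Ideal.span (Set.range fun i => X i - C (b i)) := by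
      intro q
      induction q using MvPolynomial.induction_on with
      | C a => simp
      | add p q hp hq =>
        rw [map_add, C_add, add_sub_add_comm]
        exact add_mem hp hq
      | mul_X p i hp =>
        have : p * X i - C (aeval b (p * X i)) =
            X i * (p - C (aeval b p)) + C (aeval b p) * (X i - C (b i)) := by
          simp only [map_mul, aeval_X]; ring
        rw [this]
        exact add_mem (Ideal.mul_mem_left _ _ hp)
          (Ideal.mul_mem_left _ _ (Ideal.subset_span ⟨i, rfl⟩))
    have := taylor p
    rwa [(mem_vanishingIdeal_singleton_iff b p).1 hp, C_0, sub_zero] at this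
  · rintro _ ⟨i, rfl⟩
    exact X_sub_C_mem_pointIdeal b i

theorem pointIdeal_injective : Function.Injective (pointIdeal : (ι → 𝕜) → _) := by
  intro b b' h
  funext i
  have := X_sub_C_mem_pointIdeal b i
  rw [h, mem_vanishingIdeal_singleton_iff] at this
  simpa [sub_eq_zero, eq_comm] using this

theorem isCoprime_pointIdeal {b b' : ι → 𝕜} (h : b ≠ b') :
    IsCoprime (pointIdeal b) (pointIdeal b') :=
  Ideal.isCoprime_of_isMaximal (pointIdeal_injective.ne h)

theorem exists_le_pointIdeal [IsAlgClosed 𝕜] [Finite ι] {I : Ideal (MvPolynomial ι 𝕜)}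
    (hI : I ≠ ⊤) : ∃ b, I ≤ pointIdeal b := by
  obtain ⟨𝔪, h𝔪, hI𝔪⟩ := Ideal.exists_le_maximal I hI
  obtain ⟨b, rfl⟩ := isMaximal_iff_eq_vanishingIdeal_singleton.1 h𝔪
  exact ⟨b, hI𝔪⟩

theorem vanishingIdeal_pow_eq_iInf (s : Finset (ι → 𝕜)) (n : ℕ) :
    vanishingIdeal 𝕜 (s : Set (ι → 𝕜)) ^ n = ⨅ q ∈ s, pointIdeal q ^ n := by
  have h : vanishingIdeal 𝕜 (s : Set (ι → 𝕜)) = ∏ q ∈ s, pointIdeal q := by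
    rw [Ideal.prod_eq_iInf_of_pairwise_isCoprime fun i _ j _ hij => isCoprime_pointIdeal hij]
    ext p
    simp
  rw [h, ← Finset.prod_pow, Ideal.prod_eq_iInf_of_pairwise_isCoprime]
  exact fun i _ j _ hij => (isCoprime_pointIdeal hij).pow

theorem mem_vanishingIdeal_pow_iff {s : Set (ι → 𝕜)} (hs : s.Finite) {n : ℕ}
    {p : MvPolynomial ι 𝕜} : p ∈ vanishingIdeal 𝕜 s ^ n ↔ ∀ q ∈ s, p ∈ pointIdeal q ^ n := by
  obtain ⟨s, rfl⟩ := hs.exists_finset_coe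
  simp only [vanishingIdeal_pow_eq_iInf, Ideal.mem_iInf, Finset.mem_coe]

theorem exists_forall_sub_mem_pointIdeal_pow {s : Set (ι → 𝕜)} (hs : s.Finite) (n : ℕ)
    (f : (ι → 𝕜) → MvPolynomial ι 𝕜) :
    ∃ p, ∀ q ∈ s, p - f q ∈ pointIdeal q ^ n := by
  have := hs.to_subtype
  obtain ⟨p, hp⟩ := Ideal.exists_forall_sub_mem_ideal (I := fun q : s => pointIdeal q.1 ^ n)
    (fun q q' hq => (isCoprime_pointIdeal (Subtype.coe_injective.ne hq)).pow) fun q => f q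
  exact ⟨p, fun q hq => hp ⟨q, hq⟩⟩

theorem isEuler_pointIdeal {δ : VectorField 𝕜 ι} {b : ι → 𝕜} {𝔭 : Ideal (MvPolynomial ι 𝕜)}
    (hδ : ∀ i, δ (X i) - (X i - C (b i)) ∈ pointIdeal b ^ 2 ⊔ 𝔭) :
    IsEuler δ (pointIdeal b) 𝔭 := by
  have hle : pointIdeal b ^ 2 ⊔ 𝔭 ≤ pointIdeal b ⊔ 𝔭 :=
    sup_le_sup_right (Ideal.pow_le_self two_ne_zero) _
  have hX : ∀ i, δ (X i) ∈ pointIdeal b ⊔ 𝔭 := fun i => by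
    simpa using add_mem (hle (hδ i)) (Ideal.mem_sup_left (X_sub_C_mem_pointIdeal b i))
  rw [pointIdeal_eq_span] at hδ hX ⊢
  refine isEuler_span (derivation_mem_of_X hX) ?_
  rintro _ ⟨i, rfl⟩
  simpa [derivation_C] using hδ i

theorem isEuler_vanishingIdeal {δ : VectorField 𝕜 ι} {s : Set (ι → 𝕜)} (hs : s.Finite)
    (hδ : ∀ q ∈ s, IsEuler δ (pointIdeal q) ⊥) : IsEuler δ (vanishingIdeal 𝕜 s) ⊥ := by
  simp only [isEuler_bot_iff] at hδ ⊢
  refine ⟨fun p q hq => (hδ q hq).1 p q rfl, fun p hp => ?_⟩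
  rw [mem_vanishingIdeal_pow_iff hs]
  exact fun q hq => (hδ q hq).2 p ((mem_vanishingIdeal_singleton_iff q p).2 (hp q hq))

theorem exists_isEuler_pointIdeal {s : Set (ι → 𝕜)} (hs : s.Finite) :
    ∃ δ : VectorField 𝕜 ι, ∀ q ∈ s, IsEuler δ (pointIdeal q) ⊥ := by
  choose F hF using fun i => exists_forall_sub_mem_pointIdeal_pow hs 2 fun q => X i - C (q i)
  refine ⟨mkDerivation 𝕜 F, fun q hq => isEuler_pointIdeal fun i => ?_⟩
  simpa only [mkDerivation_X, sup_bot_eq] using hF i q hq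

end Points

/-! ### Finite linear groups with a family of reflections -/

/-- A representation of `G` by matrices, together with a family of elements of `G` acting by the
reflections `1 - κ a aᵀ` with root `a` and scale `κ`, and a parameter for each of them. It records
in coordinates, for an orthonormal basis, what the defining relations of a Cherednik algebra
refer to. -/
structure ReflectionDatum (𝕜 ι G S : Type*) [Field 𝕜] [Fintype ι] [DecidableEq ι] [Group G] where
  mat : G →* Matrix ι ι 𝕜
  refl : S → G
  refl_inv : ∀ s, (refl s)⁻¹ = refl s
  root : S → ι → 𝕜
  scale : S → 𝕜
  param : S → 𝕜
  mat_refl : ∀ s, mat (refl s) = 1 - scale s • Matrix.vecMulVec (root s) (root s)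
  scale_root : ∀ s, scale s * (root s ⬝ᵥ root s) = 2

namespace ReflectionDatum

variable {𝕜 ι G S : Type*} [Field 𝕜] [Fintype ι] [DecidableEq ι] [Group G]
  (𝒟 : ReflectionDatum 𝕜 ι G S)

/-- The left action of `G` on polynomials by linear substitutions. -/
def subst (g : G) : MvPolynomial ι 𝕜 →ₐ[𝕜] MvPolynomial ι 𝕜 :=
  aeval fun j => ∑ i, 𝒟.mat g i j • X i

/-- The right action of `G` on points, regarded as row vectors. -/
def move (b : ι → 𝕜) (g : G) : ι → 𝕜 := Matrix.vecMul b (𝒟.mat g)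

@[simp] theorem subst_X (g : G) (j : ι) : 𝒟.subst g (X j) = ∑ i, 𝒟.mat g i j • X i := by
  simp only [subst, aeval_X]

@[simp] theorem subst_C (g : G) (a : 𝕜) : 𝒟.subst g (C a) = C a := by
  simp only [subst, aeval_C, algebraMap_eq]

theorem subst_mul (g h : G) : 𝒟.subst (g * h) = (𝒟.subst g).comp (𝒟.subst h) := by
  apply MvPolynomial.algHom_ext
  intro j
  simp only [subst_X, AlgHom.comp_apply, map_sum, map_smul, map_mul, Matrix.mul_apply,
    Finset.sum_smul, Finset.smul_sum, smul_smul]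
  rw [Finset.sum_comm]
  simp only [mul_comm]

theorem subst_mul_apply (g h : G) (p : MvPolynomial ι 𝕜) :
    𝒟.subst (g * h) p = 𝒟.subst g (𝒟.subst h p) := by
  rw [subst_mul, AlgHom.comp_apply]

@[simp] theorem subst_one : 𝒟.subst 1 = AlgHom.id 𝕜 _ := by
  apply MvPolynomial.algHom_ext
  simp [Matrix.one_apply]

@[simp] theorem subst_subst_inv (g : G) (p : MvPolynomial ι 𝕜) :
    𝒟.subst g (𝒟.subst g⁻¹ p) = p := by
  rw [← subst_mul_apply, mul_inv_cancel, subst_one, AlgHom.id_apply]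

theorem aeval_subst {B : Type*} [CommRing B] [Algebra 𝕜 B] (β : ι → B) (g : G)
    (p : MvPolynomial ι 𝕜) :
    aeval β (𝒟.subst g p) = aeval (fun j => ∑ i, 𝒟.mat g i j • β i) p := by
  rw [← AlgHom.comp_apply]
  congr 1
  apply MvPolynomial.algHom_ext
  simp

theorem move_apply (b : ι → 𝕜) (g : G) (j : ι) : 𝒟.move b g j = ∑ i, 𝒟.mat g i j * b i := by
  simp only [move, Matrix.vecMul, dotProduct, mul_comm]

theorem aeval_subst_eq_aeval_move (b : ι → 𝕜) (g : G) (p : MvPolynomial ι 𝕜) :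
    aeval b (𝒟.subst g p) = aeval (𝒟.move b g) p := by
  rw [aeval_subst, funext (𝒟.move_apply b g)]
  rfl

theorem move_mul (b : ι → 𝕜) (g h : G) : 𝒟.move b (g * h) = 𝒟.move (𝒟.move b g) h := by
  simp only [move, map_mul, Matrix.vecMul_vecMul]

@[simp] theorem move_one (b : ι → 𝕜) : 𝒟.move b 1 = b := by simp [move]

@[simp] theorem move_move_inv (b : ι → 𝕜) (g : G) : 𝒟.move (𝒟.move b g) g⁻¹ = b := by
  rw [← move_mul, mul_inv_cancel, move_one]

/-- The linear form attached to a root. -/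
def rootPoly (s : S) : MvPolynomial ι 𝕜 := ∑ i, 𝒟.root s i • X i

theorem subst_refl_X (s : S) (j : ι) :
    𝒟.subst (𝒟.refl s) (X j) = X j - (𝒟.scale s * 𝒟.root s j) • 𝒟.rootPoly s := by
  simp only [subst_X, mat_refl, Matrix.sub_apply, Matrix.one_apply, Matrix.smul_apply,
    Matrix.vecMulVec_apply, sub_smul, Finset.sum_sub_distrib, ite_smul, one_smul, zero_smul,
    Finset.sum_ite_eq', Finset.mem_univ, if_true, rootPoly, Finset.smul_sum, smul_smul]
  refine congrArg (X j - ·) (Finset.sum_congr rfl fun i _ => ?_)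
  rw [smul_eq_mul, mul_comm (𝒟.root s i), mul_assoc]

theorem subst_refl_rootPoly (s : S) :
    𝒟.subst (𝒟.refl s) (𝒟.rootPoly s) = - 𝒟.rootPoly s := by
  calc 𝒟.subst (𝒟.refl s) (𝒟.rootPoly s)
      = 𝒟.rootPoly s - (𝒟.scale s * (𝒟.root s ⬝ᵥ 𝒟.root s)) • 𝒟.rootPoly s := by
        conv_lhs => rw [rootPoly, map_sum]
        simp only [map_smul, subst_refl_X, smul_sub, Finset.sum_sub_distrib, smul_smul,
          ← Finset.sum_smul, dotProduct, Finset.mul_sum, mul_left_comm (𝒟.scale s)]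
        rw [← rootPoly]
    _ = - 𝒟.rootPoly s := by rw [scale_root, two_smul]; ring

theorem rootPoly_dvd_sub_subst (s : S) (p : MvPolynomial ι 𝕜) :
    𝒟.rootPoly s ∣ p - 𝒟.subst (𝒟.refl s) p := by
  induction p using MvPolynomial.induction_on with
  | C a => simp
  | add p q hp hq =>
    rw [map_add, add_sub_add_comm]
    exact dvd_add hp hq
  | mul_X p i hp =>
    have split : p * X i - 𝒟.subst (𝒟.refl s) (p * X i) = (p - 𝒟.subst (𝒟.refl s) p) * X i
        + 𝒟.subst (𝒟.refl s) p * C (𝒟.scale s * 𝒟.root s i) * 𝒟.rootPoly s := by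
      rw [map_mul, subst_refl_X, smul_eq_C_mul]; ring
    rw [split]
    exact dvd_add (Dvd.dvd.mul_right hp _) (Dvd.intro_left _ rfl)

/-! ### Equivariant vector fields -/

/-- Vector fields commuting with the action of `G`. -/
def IsEquivariant (δ : VectorField 𝕜 ι) : Prop := ∀ g p, 𝒟.subst g (δ p) = δ (𝒟.subst g p)

variable {𝒟} in
theorem IsEquivariant.smul {δ : VectorField 𝕜 ι} (hδ : 𝒟.IsEquivariant δ) (a : 𝕜) :
    𝒟.IsEquivariant (a • δ) := fun g p => by
  rw [Derivation.smul_apply, map_smul, hδ g p, Derivation.smul_apply]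

variable {𝒟} in
/-- The reflection `s` changes the sign of the root, hence that of its derivative; and every
polynomial with this property is divisible by the root. -/
theorem IsEquivariant.rootPoly_dvd [CharZero 𝕜] {δ : VectorField 𝕜 ι} (hδ : 𝒟.IsEquivariant δ)
    (s : S) : 𝒟.rootPoly s ∣ δ (𝒟.rootPoly s) := by
  have h := 𝒟.rootPoly_dvd_sub_subst s (δ (𝒟.rootPoly s))
  rw [hδ, subst_refl_rootPoly, map_neg, sub_neg_eq_add, ← two_smul 𝕜, smul_eq_C_mul] at h
  exact ((isUnit_iff_ne_zero.2 two_ne_zero).map C).dvd_mul_left.1 h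

/-- The conjugate of a vector field by an element of `G`. -/
def conj (g : G) (δ : VectorField 𝕜 ι) : VectorField 𝕜 ι :=
  Derivation.mk' ((𝒟.subst g).toLinearMap ∘ₗ δ.toLinearMap ∘ₗ (𝒟.subst g⁻¹).toLinearMap) <| by
    simp

@[simp] theorem conj_apply (g : G) (δ : VectorField 𝕜 ι) (p : MvPolynomial ι 𝕜) :
    𝒟.conj g δ p = 𝒟.subst g (δ (𝒟.subst g⁻¹ p)) := rfl

theorem isEquivariant_sum_conj [Fintype G] (δ : VectorField 𝕜 ι) :
    𝒟.IsEquivariant (∑ g, 𝒟.conj g δ) := by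
  intro g p
  simp only [derivation_sum_apply, conj_apply, map_sum, ← subst_mul_apply]
  refine Fintype.sum_equiv (Equiv.mulLeft g) _ _ fun h => ?_
  simp

theorem comap_subst_pointIdeal (b : ι → 𝕜) (g : G) :
    (pointIdeal b).comap (𝒟.subst g) = pointIdeal (𝒟.move b g) := by
  ext p
  rw [Ideal.mem_comap, mem_vanishingIdeal_singleton_iff, mem_vanishingIdeal_singleton_iff,
    aeval_subst_eq_aeval_move]

theorem isEuler_conj {δ : VectorField 𝕜 ι} {g : G} {J : Ideal (MvPolynomial ι 𝕜)}
    (hδ : IsEuler δ (J.comap (𝒟.subst g)) ⊥) : IsEuler (𝒟.conj g δ) J ⊥ := by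
  rw [isEuler_bot_iff] at hδ ⊢
  refine ⟨fun p => hδ.1 (𝒟.subst g⁻¹ p), fun p hp => ?_⟩
  have hp' : 𝒟.subst g⁻¹ p ∈ J.comap (𝒟.subst g) := by rwa [Ideal.mem_comap, subst_subst_inv]
  simpa using Ideal.le_comap_pow _ _ (hδ.2 _ hp')

/-! ### Orbits and stabilizers -/

/-- The radical ideal of the orbit of a point. -/
def orbitIdeal (b : ι → 𝕜) : Ideal (MvPolynomial ι 𝕜) := vanishingIdeal 𝕜 (Set.range (𝒟.move b))

theorem orbitIdeal_le_pointIdeal (b : ι → 𝕜) : 𝒟.orbitIdeal b ≤ pointIdeal b :=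
  vanishingIdeal_anti_mono (Set.singleton_subset_iff.2 ⟨1, 𝒟.move_one b⟩)

/-- The stabilizer of a point. -/
def stabilizer (b : ι → 𝕜) : Subgroup G where
  carrier := {g | 𝒟.move b g = b}
  one_mem' := 𝒟.move_one b
  mul_mem' {g h} hg hh := by
    simp only [Set.mem_ofPred_eq] at hg hh ⊢
    rw [move_mul, hg, hh]
  inv_mem' {g} hg := by
    simp only [Set.mem_ofPred_eq] at hg ⊢
    conv_lhs => rw [← hg]
    exact 𝒟.move_move_inv b g

theorem mem_stabilizer {b : ι → 𝕜} {g : G} : g ∈ 𝒟.stabilizer b ↔ 𝒟.move b g = b := Iff.rfl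

theorem exists_isEquivariant_isEuler [Finite G] [CharZero 𝕜] (b : ι → 𝕜) :
    ∃ δ : VectorField 𝕜 ι, 𝒟.IsEquivariant δ ∧ IsEuler δ (𝒟.orbitIdeal b) ⊥ := by
  have := Fintype.ofFinite G
  have hfin := Set.finite_range (𝒟.move b)
  obtain ⟨δ, hδ⟩ := exists_isEuler_pointIdeal hfin
  refine ⟨_, (𝒟.isEquivariant_sum_conj δ).smul (Fintype.card G : 𝕜)⁻¹,
    isEuler_vanishingIdeal hfin ?_⟩
  rintro _ ⟨g, rfl⟩
  refine IsEuler.average fun h => 𝒟.isEuler_conj ?_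
  rw [comap_subst_pointIdeal, ← move_mul]
  exact hδ _ ⟨g * h, rfl⟩

theorem conj_smul_mkDerivation_X (q : MvPolynomial ι 𝕜) (v : ι → 𝕜) (g : G) (j : ι) :
    𝒟.conj g (q • mkDerivation 𝕜 fun i => C (v i)) (X j) =
      𝒟.subst g q * C (𝒟.move v g⁻¹ j) := by
  simp [move_apply, smul_eq_C_mul, mkDerivation_X, Finset.mul_sum, mul_left_comm]

/-- An equivariant vector field takes at `b` a value fixed by the stabilizer of `b`; conversely,
every such value occurs. -/
theorem exists_isEquivariant_apply_X_sub_mem [Finite G] [CharZero 𝕜] {b v : ι → 𝕜}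
    (hv : 𝒟.stabilizer b ≤ 𝒟.stabilizer v) :
    ∃ δ : VectorField 𝕜 ι, 𝒟.IsEquivariant δ ∧ ∀ j, δ (X j) - C (v j) ∈ pointIdeal b := by
  classical
  have := Fintype.ofFinite G
  obtain ⟨q, hq⟩ := exists_forall_sub_mem_pointIdeal_pow (Set.finite_range (𝒟.move b)) 1
    fun q => if q = b then C (Fintype.card (𝒟.stabilizer b) : 𝕜)⁻¹ else 0
  have hq_move : ∀ g, aeval (𝒟.move b g) q =
      if g ∈ 𝒟.stabilizer b then (Fintype.card (𝒟.stabilizer b) : 𝕜)⁻¹ else 0 := by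
    intro g
    have := hq _ ⟨g, rfl⟩
    rw [pow_one, mem_vanishingIdeal_singleton_iff, map_sub, sub_eq_zero] at this
    rw [this]
    simp only [mem_stabilizer]
    split_ifs <;> simp
  refine ⟨∑ g, 𝒟.conj g (q • mkDerivation 𝕜 fun i => C (v i)), 𝒟.isEquivariant_sum_conj _,
    fun j => ?_⟩
  have hterm : ∀ g, aeval b (𝒟.conj g (q • mkDerivation 𝕜 fun i => C (v i)) (X j)) =
      if g ∈ 𝒟.stabilizer b then (Fintype.card (𝒟.stabilizer b) : 𝕜)⁻¹ * v j else 0 := by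
    intro g
    rw [conj_smul_mkDerivation_X, map_mul, aeval_subst_eq_aeval_move, hq_move, aeval_C, ite_mul,
      zero_mul]
    refine ite_congr rfl (fun hg => ?_) fun _ => rfl
    rw [𝒟.mem_stabilizer.1 (inv_mem (hv hg)), Algebra.algebraMap_self_apply]
  rw [mem_vanishingIdeal_singleton_iff, map_sub, aeval_C, derivation_sum_apply, map_sum,
    Finset.sum_congr rfl fun g _ => hterm g, ← Finset.sum_filter, Finset.sum_const,
    ← Fintype.card_subtype, nsmul_eq_mul, mul_inv_cancel_left₀, Algebra.algebraMap_self_apply,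
    sub_self]
  exact Nat.cast_ne_zero.2 Fintype.card_ne_zero

/-! ### Ideals stable under equivariant vector fields -/

/-- The ideal of the fixed-point subscheme of a subgroup. -/
def fixedIdeal (H : Subgroup G) : Ideal (MvPolynomial ι 𝕜) :=
  Ideal.span {p | ∃ h ∈ H, ∃ r, 𝒟.subst h r - r = p}

theorem subst_sub_mem_fixedIdeal {H : Subgroup G} {h : G} (hh : h ∈ H) (r : MvPolynomial ι 𝕜) :
    𝒟.subst h r - r ∈ 𝒟.fixedIdeal H := Ideal.subset_span ⟨h, hh, r, rfl⟩

variable {𝒟} in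
/-- Equivariant vector fields are tangent to the fixed points of every subgroup. -/
theorem IsEquivariant.apply_mem_fixedIdeal {δ : VectorField 𝕜 ι} (hδ : 𝒟.IsEquivariant δ)
    {H : Subgroup G} {p : MvPolynomial ι 𝕜} (hp : p ∈ 𝒟.fixedIdeal H) : δ p ∈ 𝒟.fixedIdeal H := by
  induction hp using Submodule.span_induction with
  | mem p hp =>
    obtain ⟨h, hh, r, rfl⟩ := hp
    rw [map_sub, ← hδ h r]
    exact 𝒟.subst_sub_mem_fixedIdeal hh _
  | zero => simp
  | add p q _ _ hp hq => rw [map_add]; exact add_mem hp hq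
  | smul r p hp ih =>
    rw [smul_eq_mul, Derivation.leibniz]
    exact add_mem (Ideal.mul_mem_left _ _ ih) (Ideal.mul_mem_right _ _ hp)

theorem subst_X_sub_C {b : ι → 𝕜} {h : G} (hh : h ∈ 𝒟.stabilizer b) (j : ι) :
    𝒟.subst h (X j - C (b j)) = ∑ i, 𝒟.mat h i j • (X i - C (b i)) := by
  conv_lhs => rw [← 𝒟.mem_stabilizer.1 hh, move_apply]
  simp [smul_sub, Finset.sum_sub_distrib, smul_eq_C_mul]

/-- `P` is the average of the matrices of the stabilizer, a projection to its fixed points. -/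
theorem exists_fixing_matrix [Finite G] [CharZero 𝕜] (b : ι → 𝕜) : ∃ P : Matrix ι ι 𝕜,
    (∀ i, 𝒟.stabilizer b ≤ 𝒟.stabilizer (P i)) ∧
      ∀ j, ∑ i, P i j • (X i - C (b i)) - (X j - C (b j)) ∈ 𝒟.fixedIdeal (𝒟.stabilizer b) := by
  have := Fintype.ofFinite (𝒟.stabilizer b)
  set n : 𝕜 := (Fintype.card (𝒟.stabilizer b) : 𝕜)
  have hn : n ≠ 0 := Nat.cast_ne_zero.2 Fintype.card_ne_zero
  set Q : Matrix ι ι 𝕜 := ∑ h : 𝒟.stabilizer b, 𝒟.mat h with hQ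
  have hQ_mul : ∀ h ∈ 𝒟.stabilizer b, Q * 𝒟.mat h = Q := fun h hh => by
    rw [hQ, Finset.sum_mul]
    exact Fintype.sum_equiv (Equiv.mulRight (⟨h, hh⟩ : 𝒟.stabilizer b)) _ _ fun g => by simp
  refine ⟨n⁻¹ • Q, fun i h hh => ?_, fun j => ?_⟩
  · rw [mem_stabilizer, move, ← Matrix.mul_apply_eq_vecMul, Matrix.smul_mul, hQ_mul h hh]
  · have haverage : ∑ i, (n⁻¹ • Q) i j • (X i - C (b i)) - (X j - C (b j)) =
        n⁻¹ • ∑ h : 𝒟.stabilizer b, (𝒟.subst h (X j - C (b j)) - (X j - C (b j))) := by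
      rw [Finset.sum_sub_distrib, Finset.sum_const, Finset.card_univ, ← Nat.cast_smul_eq_nsmul 𝕜,
        smul_sub, inv_smul_smul₀ hn, Finset.sum_congr rfl fun h _ => 𝒟.subst_X_sub_C h.2 j,
        Finset.sum_comm]
      simp only [hQ, Matrix.smul_apply, Matrix.sum_apply, ← Finset.sum_smul, smul_assoc,
        ← Finset.smul_sum]
    rw [haverage]
    exact Submodule.smul_of_tower_mem _ _
      (sum_mem fun h _ => 𝒟.subst_sub_mem_fixedIdeal h.2 _)

theorem mem_pointIdeal_of_forall_mem_pow_sup {H : Subgroup G} {b b' : ι → 𝕜}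
    (hb : H ≤ 𝒟.stabilizer b) (hb' : H ≤ 𝒟.stabilizer b') {p : MvPolynomial ι 𝕜}
    (hp : ∀ n, p ∈ pointIdeal b ^ n ⊔ 𝒟.fixedIdeal H) : p ∈ pointIdeal b' := by
  let line (i : ι) : Polynomial 𝕜 := b i • 1 + (b' i - b i) • Polynomial.X
  have hfixed : 𝒟.fixedIdeal H ≤ RingHom.ker (aeval line : MvPolynomial ι 𝕜 →ₐ[𝕜] _) := by
    refine Ideal.span_le.2 ?_
    rintro _ ⟨h, hh, r, rfl⟩
    have hline : (fun j => ∑ i, 𝒟.mat h i j • line i) = line := funext fun j => by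
      have hbj := congrFun (𝒟.mem_stabilizer.1 (hb hh)) j
      have hbj' := congrFun (𝒟.mem_stabilizer.1 (hb' hh)) j
      rw [move_apply] at hbj hbj'
      simp only [line, smul_add, smul_smul, mul_sub, Finset.sum_add_distrib, ← Finset.sum_smul,
        Finset.sum_sub_distrib, hbj, hbj']
    rw [SetLike.mem_coe, RingHom.mem_ker, map_sub, aeval_subst, hline, sub_self]
  have hpoint : pointIdeal b ≤ (Ideal.span {Polynomial.X}).comap (aeval line) := by
    rw [pointIdeal_eq_span, Ideal.span_le]
    rintro _ ⟨i, rfl⟩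
    rw [SetLike.mem_coe, Ideal.mem_comap, Ideal.mem_span_singleton]
    simp [line, Polynomial.smul_eq_C_mul]
  have hzero : aeval line p = 0 := Polynomial.ext fun n => by
    have hle : pointIdeal b ^ (n + 1) ⊔ 𝒟.fixedIdeal H ≤
        (Ideal.span {Polynomial.X ^ (n + 1)}).comap (aeval line) := by
      refine sup_le ?_ (hfixed.trans (Ideal.comap_mono bot_le))
      rw [← Ideal.span_singleton_pow]
      exact (Ideal.pow_right_mono hpoint _).trans (Ideal.le_comap_pow _ _)
    have hdvd := Ideal.mem_span_singleton.1 (Ideal.mem_comap.1 (hle (hp (n + 1))))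
    exact Polynomial.X_pow_dvd_iff.1 hdvd n n.lt_succ_self
  have hend : (Polynomial.aeval (1 : 𝕜)).comp (aeval line) = aeval b' := by
    apply MvPolynomial.algHom_ext
    simp [line]
  rw [mem_vanishingIdeal_singleton_iff, ← hend, AlgHom.comp_apply, hzero, map_zero]

/-- On the fixed points of the stabilizer of `b`, equivariant vector fields span the tangent space
at `b`. So `I` vanishes there to infinite order at `b`, hence identically. -/
theorem le_pointIdeal_of_stable [Finite G] [CharZero 𝕜] {I : Ideal (MvPolynomial ι 𝕜)}
    (hI : ∀ δ, 𝒟.IsEquivariant δ → ∀ p ∈ I, δ p ∈ I) {b b' : ι → 𝕜} (hb : I ≤ pointIdeal b)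
    (hb' : 𝒟.stabilizer b ≤ 𝒟.stabilizer b') : I ≤ pointIdeal b' := by
  obtain ⟨P, hP, hPX⟩ := 𝒟.exists_fixing_matrix b
  choose δ hδ hδX using fun i => 𝒟.exists_isEquivariant_apply_X_sub_mem (hP i)
  let ε : VectorField 𝕜 ι := ∑ i, (X i - C (b i) : MvPolynomial ι 𝕜) • δ i
  have hε : ∀ p, ε p = ∑ i, (X i - C (b i)) * δ i p := fun p => derivation_sum_apply _ _ p
  have hεuler : IsEuler ε (pointIdeal b) (𝒟.fixedIdeal (𝒟.stabilizer b)) := by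
    refine isEuler_pointIdeal fun j => ?_
    have split : ε (X j) - (X j - C (b j)) = ∑ i, (X i - C (b i)) * (δ i (X j) - C (P i j)) +
        (∑ i, P i j • (X i - C (b i)) - (X j - C (b j))) := by
      simp only [hε, mul_sub, Finset.sum_sub_distrib, smul_eq_C_mul, mul_comm]
      ring
    rw [split, pow_two]
    exact Submodule.add_mem_sup
      (sum_mem fun i _ => Ideal.mul_mem_mul (X_sub_C_mem_pointIdeal b i) (hδX i j)) (hPX j)
  have hinfinite := hεuler.le_pow_sup (I := I)
    (fun p hp => hε p ▸ sum_mem fun i _ => Ideal.mul_mem_left _ _ ((hδ i).apply_mem_fixedIdeal hp))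
    (hb.trans le_sup_left) fun n hn p hp => by
      rw [hε, pow_succ']
      exact sum_mem fun i _ =>
        mul_mem_mul_sup (X_sub_C_mem_pointIdeal b i) (hn (hI _ (hδ i) p hp))
  exact fun p hp => 𝒟.mem_pointIdeal_of_forall_mem_pow_sup le_rfl hb' fun n => hinfinite n hp

end ReflectionDatum

/-! ### Lifts of derivations -/

section Lift

variable {𝕜 R A M : Type*} [Field 𝕜] [CommRing R] [Algebra 𝕜 R] [Ring A] [Algebra 𝕜 A]
  [AddCommGroup M] [Module A M] [Module R M] {φ : R →ₐ[𝕜] A}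

/-- A submodule over `A`, regarded as a submodule over a commutative algebra mapping to `A`. -/
def restrictAlong (hM : ∀ (p : R) (m : M), p • m = φ p • m) (N : Submodule A M) :
    Submodule R M where
  carrier := N
  add_mem' := N.add_mem
  zero_mem' := N.zero_mem
  smul_mem' p m hm := by
    rw [hM]
    exact N.smul_mem _ hm

theorem restrictAlong_strictMono (hM : ∀ (p : R) (m : M), p • m = φ p • m) :
    StrictMono (restrictAlong hM) := fun _ _ h => h

variable (hM : ∀ (p : R) (m : M), p • m = φ p • m)

include hM

theorem algebraMap_smul_eq (a : 𝕜) (m : M) : algebraMap 𝕜 A a • m = algebraMap 𝕜 R a • m := by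
  rw [hM, AlgHom.commutes]

theorem aeval_smul_mem {K : Submodule R M} {d : A} (hd : ∀ m ∈ K, d • m ∈ K) (P : Polynomial 𝕜)
    {m : M} (hm : m ∈ K) : Polynomial.aeval d P • m ∈ K := by
  induction P using Polynomial.induction_on with
  | C a =>
    rw [Polynomial.aeval_C, algebraMap_smul_eq hM]
    exact K.smul_mem _ hm
  | add P Q hP hQ => rw [map_add, add_smul]; exact add_mem hP hQ
  | monomial n a ih =>
    rw [pow_succ, ← mul_assoc, mul_comm, map_mul, Polynomial.aeval_X, mul_smul]
    exact hd _ ih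

/-- If multiplication by `p` intertwines `e` on `N` with `d` modulo `K`, it does so for all
polynomials in them. -/
theorem aeval_smul_sub_mem {K : Submodule R M} {N : Submodule A M} {d e : A} {p : R}
    (hK : ∀ m ∈ K, d • m ∈ K) (hN : ∀ n ∈ N, d • p • n - p • e • n ∈ K) (P : Polynomial 𝕜)
    {n : M} (hn : n ∈ N) :
    Polynomial.aeval d P • p • n - p • Polynomial.aeval e P • n ∈ K := by
  induction P using Polynomial.induction_on with
  | C a =>
    rw [Polynomial.aeval_C, Polynomial.aeval_C, algebraMap_smul_eq hM, algebraMap_smul_eq hM,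
      smul_comm, sub_self]
    exact K.zero_mem
  | add P Q hP hQ =>
    simp only [map_add, add_smul, smul_add, add_sub_add_comm]
    exact add_mem hP hQ
  | monomial l a ih =>
    rw [pow_succ, ← mul_assoc, mul_comm]
    set Q := Polynomial.C a * Polynomial.X ^ l
    simp only [map_mul, Polynomial.aeval_X, mul_smul]
    rw [← sub_add_sub_cancel _ (d • p • Polynomial.aeval e Q • n), ← smul_sub]
    exact add_mem (hK _ ih) (hN _ (N.smul_mem _ hn))

omit hM

/-- The commutator with `d` acts on the image of `φ` as the derivation `δ`. -/
def IsLift (φ : R →ₐ[𝕜] A) (δ : Derivation 𝕜 R R) (d : A) : Prop :=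
  ∀ p, d * φ p = φ p * d + φ (δ p)

namespace IsLift

variable {δ : Derivation 𝕜 R R} {d : A}

theorem sub_algebraMap (hd : IsLift φ δ d) (a : 𝕜) : IsLift φ δ (d - algebraMap 𝕜 A a) := by
  intro p
  rw [sub_mul, mul_sub, hd, Algebra.commutes]
  abel

variable (hd : IsLift φ δ d)

include hd hM

theorem smul_smul (p : R) (m : M) : d • p • m = p • d • m + δ p • m := by
  rw [hM, hM, hM, _root_.smul_smul, hd, add_smul, mul_smul]

theorem smul_mem_ideal_smul {I : Ideal R} (hI : ∀ p ∈ I, δ p ∈ I) (N : Submodule A M) {m : M}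
    (hm : m ∈ I • restrictAlong hM N) : d • m ∈ I • restrictAlong hM N := by
  refine Submodule.smul_induction_on hm (fun p hp n hn => ?_) fun a b ha hb => ?_
  · rw [hd.smul_smul hM]
    exact add_mem (Submodule.smul_mem_smul hp (N.smul_mem _ hn))
      (Submodule.smul_mem_smul (hI p hp) hn)
  · rw [smul_add]; exact add_mem ha hb

/-- Multiplication by an element of `J ^ k` maps `N / J N` to `J ^ k N / J ^ (k + 1) N` and shifts
the eigenvalues of the lift of an Euler derivation by `k`. -/
theorem aeval_comp_smul_mem {J : Ideal R} (hδ : IsEuler δ J ⊥) {P : Polynomial 𝕜}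
    {N : Submodule A M} (hP : ∀ n ∈ N, Polynomial.aeval d P • n ∈ J • restrictAlong hM N) (k : ℕ)
    {m : M} (hm : m ∈ J ^ k • restrictAlong hM N) :
    Polynomial.aeval d (P.comp (Polynomial.X - Polynomial.C (k : 𝕜))) • m ∈
      J ^ (k + 1) • restrictAlong hM N := by
  have hδk : ∀ l : ℕ, ∀ p ∈ J ^ l, δ p - l * p ∈ J ^ (l + 1) := by
    simpa only [sup_bot_eq] using hδ.apply_sub_natCast_mul_mem
  have hstable : ∀ p ∈ J ^ (k + 1), δ p ∈ J ^ (k + 1) := fun p hp => by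
    have hle := Ideal.pow_le_pow_right (I := J) (k + 1).le_succ
    simpa using add_mem (hle (hδk (k + 1) p hp)) (Ideal.mul_mem_left _ ((k + 1 : ℕ) : R) hp)
  have hcomp : Polynomial.aeval d (P.comp (Polynomial.X - Polynomial.C (k : 𝕜))) =
      Polynomial.aeval (d - algebraMap 𝕜 A k) P := by
    simp [Polynomial.aeval_comp]
  have hshift := hd.sub_algebraMap (k : 𝕜)
  rw [hcomp]
  refine Submodule.smul_induction_on hm (fun p hp n hn => ?_) fun a b ha hb => ?_
  · have hintertwine : Polynomial.aeval (d - algebraMap 𝕜 A k) P • p • n -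
        p • Polynomial.aeval d P • n ∈ J ^ (k + 1) • restrictAlong hM N := by
      refine aeval_smul_sub_mem hM (N := N)
        (fun m hm => hshift.smul_mem_ideal_smul hM hstable N hm) (fun n hn => ?_) P hn
      have : (d - algebraMap 𝕜 A k) • p • n - p • d • n = (δ p - (k : R) * p) • n := by
        rw [sub_smul, hd.smul_smul hM, algebraMap_smul_eq hM, map_natCast, sub_smul, mul_smul]
        abel
      rw [this]
      exact Submodule.smul_mem_smul (hδk k p hp) hn
    have hpP : p • Polynomial.aeval d P • n ∈ J ^ (k + 1) • restrictAlong hM N := by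
      rw [pow_succ, ← smul_eq_mul, Submodule.smul_assoc]
      exact Submodule.smul_mem_smul hp (hP n hn)
    simpa using add_mem hintertwine hpP
  · rw [smul_add]; exact add_mem ha hb

end IsLift

end Lift

theorem exists_aeval_mem_map_ker {𝕜 A V F : Type*} [Field 𝕜] [Ring A] [Algebra 𝕜 A]
    [AddCommGroup V] [Module 𝕜 V] [AddCommGroup F] [Module 𝕜 F] [FiniteDimensional 𝕜 F]
    {a : A} {Φ : V →ₗ[𝕜] A} (h1 : 1 ∈ Φ.range) (ha : ∀ b ∈ Φ.range, a * b ∈ Φ.range)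
    (ev : V →ₗ[𝕜] F) : ∃ P : Polynomial 𝕜, P ≠ 0 ∧ Polynomial.aeval a P ∈ ev.ker.map Φ := by
  have hrange : ∀ P : Polynomial 𝕜, Polynomial.aeval a P ∈ Φ.range := fun P => by
    induction P using Polynomial.induction_on with
    | C c =>
      rw [Polynomial.aeval_C, Algebra.algebraMap_eq_smul_one]
      exact Submodule.smul_mem _ _ h1
    | add P Q hP hQ => rw [map_add]; exact add_mem hP hQ
    | monomial n c ih =>
      rw [pow_succ, ← mul_assoc, mul_comm, map_mul, Polynomial.aeval_X]
      exact ha _ ih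
  obtain ⟨σ, hσ⟩ := Φ.rangeRestrict.exists_rightInverse_of_surjective Φ.range_rangeRestrict
  let Ψ : Polynomial 𝕜 →ₗ[𝕜] V := σ ∘ₗ (Polynomial.aeval a).toLinearMap.codRestrict _ hrange
  have hΨ : ∀ P, Φ (Ψ P) = Polynomial.aeval a P := fun P =>
    congrArg Subtype.val (LinearMap.congr_fun hσ ⟨_, hrange P⟩)
  have hker : (ev ∘ₗ Ψ).ker ≠ ⊥ := fun h =>
    Polynomial.not_finite (R := 𝕜) (Module.Finite.of_injective _ (LinearMap.ker_eq_bot.1 h))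
  obtain ⟨P, hP, hP0⟩ := Submodule.exists_mem_ne_zero_of_ne_bot hker
  exact ⟨P, hP0, Ψ P, hP, hΨ P⟩

/-! ### Realizations -/

open scoped IsMulCommutative in
theorem exists_algHom_of_commute {ι k A : Type*} [CommSemiring k] [Semiring A] [Algebra k A]
    {x : ι → A} (hx : ∀ i j, x i * x j = x j * x i) :
    ∃ φ : MvPolynomial ι k →ₐ[k] A, ∀ i, φ (X i) = x i := by
  have hcomm : ∀ a ∈ Set.range x, ∀ b ∈ Set.range x, a * b = b * a := by
    rintro _ ⟨i, rfl⟩ _ ⟨j, rfl⟩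
    exact hx i j
  have := Algebra.isMulCommutative_adjoin k hcomm
  let f : ι → Algebra.adjoin k (Set.range x) := fun i => ⟨x i, Algebra.subset_adjoin ⟨i, rfl⟩⟩
  exact ⟨(Algebra.adjoin k (Set.range x)).val.comp (aeval f), fun i => by simp [f]⟩

theorem ReflectionDatum.mul_algHom_eq {𝕜 ι G S A : Type*} [Field 𝕜] [Fintype ι] [DecidableEq ι]
    [Group G] [Ring A] [Algebra 𝕜 A] (𝒟 : ReflectionDatum 𝕜 ι G S) {φ : MvPolynomial ι 𝕜 →ₐ[𝕜] A}
    {w : A} {g : G} (h : ∀ j, w * φ (X j) = ∑ i, 𝒟.mat g i j • (φ (X i) * w))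
    (p : MvPolynomial ι 𝕜) : w * φ p = φ (𝒟.subst g p) * w := by
  induction p using MvPolynomial.induction_on with
  | C a => rw [𝒟.subst_C, MvPolynomial.algHom_C, Algebra.commutes]
  | add p q hp hq => rw [map_add, map_add, map_add, mul_add, add_mul, hp, hq]
  | mul_X p j hp =>
    have hX : w * φ (X j) = φ (𝒟.subst g (X j)) * w := by
      simp only [h, subst_X, map_sum, map_smul, Finset.sum_mul, smul_mul_assoc]
    rw [map_mul, map_mul, map_mul, ← mul_assoc, hp, mul_assoc, hX, mul_assoc]

/-- Elements of an algebra which satisfy the relations of a Cherednik algebra, except those which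
concern momenta only. -/
structure Realization {𝕜 ι G S : Type*} [Field 𝕜] [Fintype ι] [DecidableEq ι] [Group G]
    [Fintype S] (𝒟 : ReflectionDatum 𝕜 ι G S) (A : Type*) [Ring A] [Algebra 𝕜 A] where
  x : ι → A
  y : ι → A
  w : G →* A
  x_comm : ∀ i j, x i * x j = x j * x i
  w_x : ∀ g j, w g * x j = ∑ i, 𝒟.mat g i j • (x i * w g)
  y_x : ∀ i j, y i * x j - x j * y i = (if i = j then 1 else 0) +
    ∑ s, (𝒟.param s * 𝒟.scale s * 𝒟.root s i * 𝒟.root s j) • w (𝒟.refl s)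

namespace Realization

variable {𝕜 ι G S : Type*} [Field 𝕜] [Fintype ι] [DecidableEq ι] [Group G] [Fintype S]
  {𝒟 : ReflectionDatum 𝕜 ι G S} {A : Type*} [Ring A] [Algebra 𝕜 A] (ρ : Realization 𝒟 A)

/-- The homomorphism evaluating polynomials at the coordinates of a realization. -/
def poly : MvPolynomial ι 𝕜 →ₐ[𝕜] A := (exists_algHom_of_commute ρ.x_comm).choose

@[simp] theorem poly_X (i : ι) : ρ.poly (X i) = ρ.x i :=
  (exists_algHom_of_commute ρ.x_comm).choose_spec i

theorem w_mul_poly (g : G) (p : MvPolynomial ι 𝕜) :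
    ρ.w g * ρ.poly p = ρ.poly (𝒟.subst g p) * ρ.w g :=
  𝒟.mul_algHom_eq (fun j => by simpa using ρ.w_x g j) p

/-- The vector field `δ` with the partial derivatives replaced by the momenta. -/
def momentumPart (δ : VectorField 𝕜 ι) : A := ∑ i, ρ.poly (δ (X i)) * ρ.y i

/-- The combination of reflections which corrects `momentumPart δ` when `q s` is the quotient of
`δ (rootPoly s)` by `rootPoly s`. -/
def groupPart (q : S → MvPolynomial ι 𝕜) : A :=
  ∑ s, 𝒟.param s • (ρ.poly (q s) * ρ.w (𝒟.refl s))

theorem momentumPart_mul_x_sub (δ : VectorField 𝕜 ι) (j : ι) :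
    ρ.momentumPart δ * ρ.x j - ρ.x j * ρ.momentumPart δ = ρ.poly (δ (X j)) +
      ∑ s, (𝒟.param s * 𝒟.scale s * 𝒟.root s j) •
        (ρ.poly (δ (𝒟.rootPoly s)) * ρ.w (𝒟.refl s)) := by
  have hterm : ∀ i, ρ.poly (δ (X i)) * ρ.y i * ρ.x j - ρ.x j * (ρ.poly (δ (X i)) * ρ.y i) =
      (if i = j then ρ.poly (δ (X i)) else 0) + ∑ s, (𝒟.param s * 𝒟.scale s * 𝒟.root s j) •
        (𝒟.root s i • ρ.poly (δ (X i)) * ρ.w (𝒟.refl s)) := by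
    intro i
    rw [← ρ.poly_X j, ← mul_assoc, ← map_mul, mul_comm (X j), map_mul, mul_assoc, mul_assoc,
      ← mul_sub, ρ.poly_X, ρ.y_x, mul_add, mul_ite, mul_one, mul_zero, Finset.mul_sum]
    refine congrArg _ (Finset.sum_congr rfl fun s _ => ?_)
    rw [mul_smul_comm, smul_mul_assoc, smul_smul, mul_right_comm]
  have hroot : ∀ s, ∑ i, 𝒟.root s i • ρ.poly (δ (X i)) = ρ.poly (δ (𝒟.rootPoly s)) := fun s => by
    simp only [ReflectionDatum.rootPoly, map_sum, Derivation.map_smul, map_smul]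
  rw [momentumPart, Finset.sum_mul, Finset.mul_sum, ← Finset.sum_sub_distrib,
    Finset.sum_congr rfl fun i _ => hterm i, Finset.sum_add_distrib, Finset.sum_ite_eq',
    if_pos (Finset.mem_univ j), Finset.sum_comm]
  simp only [← Finset.smul_sum, ← Finset.sum_mul, hroot]

theorem groupPart_mul_x_sub (q : S → MvPolynomial ι 𝕜) (j : ι) :
    ρ.groupPart q * ρ.x j - ρ.x j * ρ.groupPart q =
      - ∑ s, (𝒟.param s * 𝒟.scale s * 𝒟.root s j) •
        (ρ.poly (𝒟.rootPoly s * q s) * ρ.w (𝒟.refl s)) := by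
  have hterm : ∀ s, ρ.poly (q s) * ρ.w (𝒟.refl s) * ρ.x j -
      ρ.x j * (ρ.poly (q s) * ρ.w (𝒟.refl s)) =
      - (𝒟.scale s * 𝒟.root s j) • (ρ.poly (𝒟.rootPoly s * q s) * ρ.w (𝒟.refl s)) := by
    intro s
    rw [← ρ.poly_X j, mul_assoc, ρ.w_mul_poly, 𝒟.subst_refl_X, ← mul_assoc, ← mul_assoc,
      ← sub_mul, ← map_mul, ← map_mul, ← map_sub, ← smul_mul_assoc, ← map_smul]
    congr 2
    rw [neg_smul, smul_eq_C_mul, smul_eq_C_mul]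
    ring
  rw [groupPart, Finset.sum_mul, Finset.mul_sum, ← Finset.sum_sub_distrib,
    ← Finset.sum_neg_distrib]
  refine Finset.sum_congr rfl fun s _ => ?_
  rw [smul_mul_assoc, mul_smul_comm, ← smul_sub, hterm, neg_smul, smul_neg, smul_smul, mul_assoc]

theorem isLift_momentumPart_add_groupPart {δ : VectorField 𝕜 ι} {q : S → MvPolynomial ι 𝕜}
    (hq : ∀ s, δ (𝒟.rootPoly s) = 𝒟.rootPoly s * q s) :
    IsLift ρ.poly δ (ρ.momentumPart δ + ρ.groupPart q) := by
  intro p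
  induction p using MvPolynomial.induction_on with
  | C a => rw [derivation_C, map_zero, add_zero, MvPolynomial.algHom_C, Algebra.commutes]
  | add p q hp hq =>
    simp only [map_add, mul_add, hp, hq, add_mul]
    abel
  | mul_X p j hp =>
    have hX : (ρ.momentumPart δ + ρ.groupPart q) * ρ.x j =
        ρ.poly (δ (X j)) + ρ.x j * (ρ.momentumPart δ + ρ.groupPart q) := by
      refine eq_add_of_sub_eq ?_
      rw [add_mul, mul_add, add_sub_add_comm, momentumPart_mul_x_sub, groupPart_mul_x_sub]
      simp only [hq, add_neg_cancel_right]
    rw [Derivation.leibniz, smul_eq_mul, smul_eq_mul, mul_comm (X j), map_mul, map_add, map_mul,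
      map_mul, poly_X, ← mul_assoc, hp, add_mul, mul_assoc, hX, mul_add, mul_assoc]
    abel

theorem exists_isLift [CharZero 𝕜] {δ : VectorField 𝕜 ι} (hδ : 𝒟.IsEquivariant δ) :
    ∃ q, IsLift ρ.poly δ (ρ.momentumPart δ + ρ.groupPart q) := by
  choose q hq using hδ.rootPoly_dvd
  exact ⟨q, ρ.isLift_momentumPart_add_groupPart hq⟩

/-- The subspace `𝕜[x] G` is stable under `groupPart q` and finite-dimensional modulo the ideal of
an orbit. -/
theorem exists_aeval_groupPart_eq_sum [Fintype G] (q : S → MvPolynomial ι 𝕜) (b : ι → 𝕜) :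
    ∃ P : Polynomial 𝕜, P ≠ 0 ∧ ∃ r : G → MvPolynomial ι 𝕜, (∀ g, r g ∈ 𝒟.orbitIdeal b) ∧
      Polynomial.aeval (ρ.groupPart q) P = ∑ g, ρ.poly (r g) * ρ.w g := by
  classical
  let Φ : (G → MvPolynomial ι 𝕜) →ₗ[𝕜] A :=
    ∑ g, LinearMap.mulRight 𝕜 (ρ.w g) ∘ₗ ρ.poly.toLinearMap ∘ₗ LinearMap.proj g
  have hΦ : ∀ r, Φ r = ∑ g, ρ.poly (r g) * ρ.w g := fun r => by simp [Φ]
  have hsingle : ∀ g p, ρ.poly p * ρ.w g ∈ Φ.range := by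
    intro g p
    refine ⟨Pi.single g p, ?_⟩
    rw [hΦ, Finset.sum_eq_single g (fun h _ hh => by simp [hh]) (by simp), Pi.single_eq_same]
  have hmul : ∀ a ∈ Φ.range, ρ.groupPart q * a ∈ Φ.range := by
    rintro _ ⟨r, rfl⟩
    rw [hΦ, groupPart, Finset.sum_mul_sum]
    refine sum_mem fun s _ => sum_mem fun g _ => ?_
    rw [smul_mul_assoc, mul_assoc, ← mul_assoc (ρ.w _), w_mul_poly, mul_assoc, ← map_mul,
      ← mul_assoc, ← map_mul]
    exact Submodule.smul_mem _ _ (hsingle _ _)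
  let ev : (G → MvPolynomial ι 𝕜) →ₗ[𝕜] (G → Set.range (𝒟.move b) → 𝕜) :=
    LinearMap.pi fun g => LinearMap.pi fun q => (aeval q.1).toLinearMap ∘ₗ LinearMap.proj g
  have : Finite (Set.range (𝒟.move b)) := Set.finite_range _
  obtain ⟨P, hP, r, hr, hrP⟩ :=
    exists_aeval_mem_map_ker (by simpa using hsingle 1 1) hmul ev
  exact ⟨P, hP, r, fun g z hz => congrFun (congrFun (LinearMap.mem_ker.1 hr) g) ⟨z, hz⟩,
    by rw [← hrP, hΦ]⟩

variable {M : Type*} [AddCommGroup M] [Module A M] [Module (MvPolynomial ι 𝕜) M]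

/-- The polynomial `P` does not depend on `N`; this makes Artin–Rees exponents uniform. -/
theorem exists_aeval_smul_mem [Finite G]
    (hM : ∀ (p : MvPolynomial ι 𝕜) (m : M), p • m = ρ.poly p • m) {b : ι → 𝕜}
    {δ : VectorField 𝕜 ι} (hδ : ∀ p, δ p ∈ 𝒟.orbitIdeal b) {q : S → MvPolynomial ι 𝕜}
    (hlift : IsLift ρ.poly δ (ρ.momentumPart δ + ρ.groupPart q)) :
    ∃ P : Polynomial 𝕜, P ≠ 0 ∧ ∀ N : Submodule A M, ∀ n ∈ N,
      Polynomial.aeval (ρ.momentumPart δ + ρ.groupPart q) P • n ∈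
        𝒟.orbitIdeal b • restrictAlong hM N := by
  have := Fintype.ofFinite G
  obtain ⟨P, hP, r, hr, hPr⟩ := ρ.exists_aeval_groupPart_eq_sum q b
  refine ⟨P, hP, fun N n hn => ?_⟩
  set K := 𝒟.orbitIdeal b • restrictAlong hM N
  have hmomentum : ∀ n ∈ N, ρ.momentumPart δ • n ∈ K := by
    intro n hn
    rw [momentumPart, Finset.sum_smul]
    refine sum_mem fun i _ => ?_
    rw [mul_smul, ← hM]
    exact Submodule.smul_mem_smul (hδ _) (N.smul_mem _ hn)
  have hcompare := aeval_smul_sub_mem hM (p := 1) (N := N) (e := ρ.groupPart q)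
    (fun m hm => hlift.smul_mem_ideal_smul hM (fun p _ => hδ p) N hm)
    (fun n hn => by simpa [add_smul] using hmomentum n hn) P hn
  have hgroup : Polynomial.aeval (ρ.groupPart q) P • n ∈ K := by
    rw [hPr, Finset.sum_smul]
    refine sum_mem fun g _ => ?_
    rw [mul_smul, ← hM]
    exact Submodule.smul_mem_smul (hr g) (N.smul_mem _ hn)
  simpa only [one_smul, sub_add_cancel] using add_mem hcompare hgroup

end Realization

/-! ### Finite length of coherent modules -/

theorem exists_forall_isCoprime_comp {𝕜 : Type*} [Field 𝕜] [CharZero 𝕜] {P : Polynomial 𝕜}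
    (hP : P ≠ 0) :
    ∃ k : ℕ, ∀ j ≥ k, IsCoprime P (P.comp (Polynomial.X - Polynomial.C (j : 𝕜))) := by
  let K := AlgebraicClosure 𝕜
  have : CharZero K := charZero_of_injective_algebraMap (algebraMap 𝕜 K).injective
  let roots := P.rootSet K
  have hroots : roots.Finite := P.rootSet_finite K
  have hdiff : {j : ℕ | ∃ z ∈ roots, ∃ z' ∈ roots, z - z' = j}.Finite := by
    refine ((hroots.image2 (· - ·) hroots).preimage Nat.cast_injective.injOn).subset ?_
    rintro j ⟨z, hz, z', hz', h⟩
    exact ⟨z, hz, z', hz', h⟩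
  obtain ⟨k, hk⟩ := hdiff.bddAbove
  refine ⟨k + 1, fun j hj => ?_⟩
  rw [Polynomial.isCoprime_iff_aeval_ne_zero_of_isAlgClosed (k := 𝕜) K]
  intro z
  by_contra! h
  have hz : z ∈ roots := (Polynomial.mem_rootSet_of_ne hP).2 h.1
  have hz' : z - j ∈ roots :=
    (Polynomial.mem_rootSet_of_ne hP).2 (by simpa [Polynomial.aeval_comp] using h.2)
  have : j ≤ k := hk ⟨z, hz, z - j, hz', sub_sub_cancel _ _⟩
  omega

section Artinian

variable {𝕜 ι : Type*} [Field 𝕜] {s : Set (ι → 𝕜)}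

theorem isMaximal_of_vanishingIdeal_le (hs : s.Finite) {P : Ideal (MvPolynomial ι 𝕜)} [P.IsPrime]
    (h : vanishingIdeal 𝕜 s ≤ P) : P.IsMaximal := by
  obtain ⟨s, rfl⟩ := hs.exists_finset_coe
  rw [← pow_one (vanishingIdeal 𝕜 _), vanishingIdeal_pow_eq_iInf, ← Finset.inf_eq_iInf] at h
  obtain ⟨q, -, hq⟩ := (Ideal.IsPrime.inf_le' ‹_›).1 h
  rw [pow_one] at hq
  rw [← (inferInstance : (pointIdeal q).IsMaximal).eq_of_le (Ideal.IsPrime.ne_top ‹_›) hq]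
  infer_instance

theorem isArtinianRing_quotient_vanishingIdeal_pow [Finite ι] (hs : s.Finite) (k : ℕ) :
    IsArtinianRing (MvPolynomial ι 𝕜 ⧸ vanishingIdeal 𝕜 s ^ k) := by
  have : Ring.KrullDimLE 0 (MvPolynomial ι 𝕜 ⧸ vanishingIdeal 𝕜 s ^ k) := by
    rw [Ring.krullDimLE_zero_iff]
    intro P hP
    set π := Ideal.Quotient.mk (vanishingIdeal 𝕜 s ^ k)
    have hπ : Function.Surjective π := Ideal.Quotient.mk_surjective
    have hker : vanishingIdeal 𝕜 s ^ k ≤ P.comap π := Ideal.mk_ker.ge.trans (Ideal.ker_le_comap π)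
    have := isMaximal_of_vanishingIdeal_le hs (Ideal.IsPrime.le_of_pow_le hker)
    rw [← Ideal.map_comap_of_surjective π hπ P] at hP ⊢
    exact (Ideal.map_eq_top_or_isMaximal_of_surjective π hπ this).resolve_left hP.ne_top
  exact IsNoetherianRing.isArtinianRing_of_krullDimLE_zero

theorem isArtinian_quotient_vanishingIdeal_pow [Finite ι] (hs : s.Finite) (k : ℕ) (M : Type*)
    [AddCommGroup M] [Module (MvPolynomial ι 𝕜) M] [Module.Finite (MvPolynomial ι 𝕜) M] :
    IsArtinian (MvPolynomial ι 𝕜)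
      (M ⧸ vanishingIdeal 𝕜 s ^ k • (⊤ : Submodule (MvPolynomial ι 𝕜) M)) := by
  have := isArtinianRing_quotient_vanishingIdeal_pow hs k
  have : Module.Finite (MvPolynomial ι 𝕜 ⧸ vanishingIdeal 𝕜 s ^ k)
      (M ⧸ vanishingIdeal 𝕜 s ^ k • (⊤ : Submodule (MvPolynomial ι 𝕜) M)) :=
    Module.Finite.of_restrictScalars_finite (MvPolynomial ι 𝕜) _ _
  exact isArtinian_of_surjective_algebraMap
    (R := MvPolynomial ι 𝕜 ⧸ vanishingIdeal 𝕜 s ^ k) Ideal.Quotient.mk_surjective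

end Artinian

/-- Multiplication by powers of `J` shifts the eigenvalues of `d` on `M / J M`, so that for large
`k` its eigenvalues on `J ^ k M / J ^ (k + m) M` are not roots of `P`. -/
theorem IsLift.exists_isCoprime_aeval_smul_mem {𝕜 R A M : Type*} [Field 𝕜] [CommRing R]
    [Algebra 𝕜 R] [Ring A] [Algebra 𝕜 A] [AddCommGroup M] [Module A M] [Module R M]
    {φ : R →ₐ[𝕜] A} (hM : ∀ (p : R) (m : M), p • m = φ p • m)
    {δ : Derivation 𝕜 R R} {d : A} (hd : IsLift φ δ d) {J : Ideal R} (hδ : IsEuler δ J ⊥)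
    {P : Polynomial 𝕜} {N : Submodule A M}
    (hP : ∀ n ∈ N, Polynomial.aeval d P • n ∈ J • restrictAlong hM N) {k : ℕ}
    (hk : ∀ j ≥ k, IsCoprime P (P.comp (Polynomial.X - Polynomial.C (j : 𝕜)))) (m : ℕ) :
    ∃ Q : Polynomial 𝕜, IsCoprime P Q ∧ ∀ z ∈ J ^ k • restrictAlong hM N,
      Polynomial.aeval d Q • z ∈ J ^ (k + m) • restrictAlong hM N := by
  induction m with
  | zero => exact ⟨1, isCoprime_one_right, fun z hz => by simpa using hz⟩
  | succ m ih =>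
    obtain ⟨Q, hPQ, hQ⟩ := ih
    refine ⟨P.comp (Polynomial.X - Polynomial.C ((k + m : ℕ) : 𝕜)) * Q,
      (hk _ (Nat.le_add_right k m)).mul_right hPQ, fun z hz => ?_⟩
    rw [map_mul, mul_smul]
    exact hd.aeval_comp_smul_mem hM hδ hP (k + m) (hQ z hz)

/-- Since `J ^ (k + m) M ∩ N ≤ J N` for large `m` depending on `N`, the separation of eigenvalues
on `J ^ k M / J ^ (k + m) M` and `N / J N` gives this for `m = 0`. -/
theorem IsLift.pow_smul_top_inf_le {𝕜 R A M : Type*} [Field 𝕜] [CommRing R] [IsNoetherianRing R]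
    [Algebra 𝕜 R] [Ring A] [Algebra 𝕜 A] [AddCommGroup M] [Module A M] [Module R M]
    [Module.Finite R M] {φ : R →ₐ[𝕜] A} (hM : ∀ (p : R) (m : M), p • m = φ p • m)
    {δ : Derivation 𝕜 R R} {d : A} (hd : IsLift φ δ d) {J : Ideal R} (hδ : IsEuler δ J ⊥)
    {P : Polynomial 𝕜}
    (hP : ∀ N : Submodule A M, ∀ n ∈ N, Polynomial.aeval d P • n ∈ J • restrictAlong hM N) {k : ℕ}
    (hk : ∀ j ≥ k, IsCoprime P (P.comp (Polynomial.X - Polynomial.C (j : 𝕜))))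
    (N : Submodule A M) : J ^ k • ⊤ ⊓ restrictAlong hM N ≤ J • restrictAlong hM N := by
  obtain ⟨l, hl⟩ := Ideal.exists_pow_inf_eq_pow_smul J (restrictAlong hM N)
  have hArtinRees : J ^ (k + (l + 1)) • ⊤ ⊓ restrictAlong hM N ≤ J • restrictAlong hM N := by
    refine (inf_le_inf_right _ (Submodule.smul_mono_left
      (Ideal.pow_le_pow_right (Nat.le_add_left _ _)))).trans ?_
    rw [hl (l + 1) l.le_succ, Nat.add_sub_cancel_left, pow_one]
    exact smul_mono_right _ inf_le_right
  obtain ⟨Q, ⟨u, v, huv⟩, hQ⟩ :=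
    hd.exists_isCoprime_aeval_smul_mem hM hδ (hP ⊤) hk (l + 1)
  rintro z ⟨hz, hzN⟩
  have hstable : ∀ m ∈ J • restrictAlong hM N, d • m ∈ J • restrictAlong hM N := fun m hm =>
    hd.smul_mem_ideal_smul hM (fun p _ => by simpa using hδ.apply_mem p) N hm
  have hPz : Polynomial.aeval d P • z ∈ J • restrictAlong hM N := hP N z hzN
  have hQz : Polynomial.aeval d Q • z ∈ J • restrictAlong hM N :=
    hArtinRees ⟨hQ z hz, N.smul_mem _ hzN⟩
  have hbezout := add_mem (aeval_smul_mem hM hstable u hPz) (aeval_smul_mem hM hstable v hQz)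
  rwa [_root_.smul_smul, _root_.smul_smul, ← add_smul, ← map_mul, ← map_mul, ← map_add, huv,
    map_one, one_smul] at hbezout

theorem IsLift.apply_mem_colon {𝕜 R A M : Type*} [Field 𝕜] [CommRing R]
    [Algebra 𝕜 R] [Ring A] [Algebra 𝕜 A] [AddCommGroup M] [Module A M] [Module R M]
    {φ : R →ₐ[𝕜] A} (hM : ∀ (p : R) (m : M), p • m = φ p • m)
    {δ : Derivation 𝕜 R R} {d : A} (hd : IsLift φ δ d) {N' N : Submodule A M} {p : R}
    (hp : p ∈ (restrictAlong hM N').colon (restrictAlong hM N : Set M)) :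
    δ p ∈ (restrictAlong hM N').colon (restrictAlong hM N : Set M) := by
  rw [Submodule.mem_colon] at hp ⊢
  intro n hn
  rw [← sub_eq_of_eq_add' (hd.smul_smul hM p n)]
  exact sub_mem (N'.smul_mem d (hp n hn)) (hp _ (N.smul_mem d hn))

theorem colon_sup_eq_top_of_le_sup_smul {R M : Type*} [CommRing R] [AddCommGroup M] [Module R M]
    {I : Ideal R} {N' N : Submodule R M} (hN : N.FG) (h : N ≤ N' ⊔ I • N) :
    N'.colon (N : Set M) ⊔ I = ⊤ := by
  have hle : N.map N'.mkQ ≤ I • N.map N'.mkQ := by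
    have := Submodule.map_mono (f := N'.mkQ) h
    rwa [Submodule.map_sup, Submodule.map_smul'', Submodule.mkQ_map_self, bot_sup_eq] at this
  obtain ⟨r, hr, hrN⟩ :=
    Submodule.exists_sub_one_mem_and_smul_eq_zero_of_fg_of_le_smul I _ (hN.map _) hle
  have hr' : r ∈ N'.colon (N : Set M) := Submodule.mem_colon.2 fun n hn => by
    rw [← Submodule.Quotient.mk_eq_zero, Submodule.Quotient.mk_smul]
    exact hrN _ (Submodule.mem_map_of_mem hn)
  rw [Ideal.eq_top_iff_one]
  simpa using sub_mem (Ideal.mem_sup_left hr') (Ideal.mem_sup_right hr)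

namespace Realization

variable {𝕜 ι G S : Type*} [Field 𝕜] [Fintype ι] [DecidableEq ι] [Group G] [Fintype S]
  {𝒟 : ReflectionDatum 𝕜 ι G S} {A : Type*} [Ring A] [Algebra 𝕜 A] (ρ : Realization 𝒟 A)
  {M : Type*} [AddCommGroup M] [Module A M] [Module (MvPolynomial ι 𝕜) M]
  (hM : ∀ (p : MvPolynomial ι 𝕜) (m : M), p • m = ρ.poly p • m)

theorem exists_orbitIdeal_pow_smul_top_inf_le [CharZero 𝕜] [Finite G]
    [Module.Finite (MvPolynomial ι 𝕜) M] (b : ι → 𝕜) :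
    ∃ k : ℕ, ∀ N : Submodule A M, 𝒟.orbitIdeal b ^ k • ⊤ ⊓ restrictAlong hM N ≤
      𝒟.orbitIdeal b • restrictAlong hM N := by
  obtain ⟨δ, hequiv, hδ⟩ := 𝒟.exists_isEquivariant_isEuler b
  obtain ⟨q, hlift⟩ := ρ.exists_isLift hequiv
  obtain ⟨P, hP0, hP⟩ :=
    ρ.exists_aeval_smul_mem hM (fun p => by simpa using hδ.apply_mem p) hlift
  obtain ⟨k, hk⟩ := exists_forall_isCoprime_comp hP0
  exact ⟨k, hlift.pow_smul_top_inf_le hM hδ hP hk⟩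

/-- The support of `N / N'` contains every point whose stabilizer contains that of some point of
the support. -/
theorem exists_forall_not_le_sup_orbitIdeal_smul [CharZero 𝕜] [IsAlgClosed 𝕜] [Finite G]
    [Module.Finite (MvPolynomial ι 𝕜) M] {N' N : Submodule A M} (h : N' < N) :
    ∃ b₀, ∀ b, 𝒟.stabilizer b₀ ≤ 𝒟.stabilizer b →
      ¬ restrictAlong hM N ≤ restrictAlong hM N' ⊔ 𝒟.orbitIdeal b • restrictAlong hM N := by
  set I := (restrictAlong hM N').colon (restrictAlong hM N : Set M)
  have hI : I ≠ ⊤ := fun hI =>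
    h.not_ge ((Submodule.colon_eq_top_iff_subset (N := restrictAlong hM N') _).1 hI)
  have hIstable : ∀ δ, 𝒟.IsEquivariant δ → ∀ p ∈ I, δ p ∈ I := fun δ hδ p hp => by
    obtain ⟨q, hlift⟩ := ρ.exists_isLift hδ
    exact hlift.apply_mem_colon hM hp
  obtain ⟨b₀, hb₀⟩ := exists_le_pointIdeal hI
  refine ⟨b₀, fun b hb hle => ?_⟩
  refine Ideal.IsMaximal.ne_top (inferInstance : (pointIdeal b).IsMaximal) (top_le_iff.1 ?_)
  rw [← colon_sup_eq_top_of_le_sup_smul (IsNoetherian.noetherian _) hle]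
  exact sup_le (𝒟.le_pointIdeal_of_stable hIstable hb₀ hb) (𝒟.orbitIdeal_le_pointIdeal b)

include hM

/-- A submodule is determined, among those comparable to it, by its images in Artinian quotients of
`M`, one for each of the finitely many stabilizers of points. -/
theorem isArtinian [CharZero 𝕜] [IsAlgClosed 𝕜] [Finite G]
    [Module.Finite (MvPolynomial ι 𝕜) M] : IsArtinian A M := by
  choose k hk using ρ.exists_orbitIdeal_pow_smul_top_inf_le hM
  choose pt hpt using fun H : Set.range 𝒟.stabilizer => H.2
  let K (b : ι → 𝕜) : Submodule (MvPolynomial ι 𝕜) M := 𝒟.orbitIdeal b ^ k b • ⊤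
  have : ∀ b, IsArtinian (MvPolynomial ι 𝕜) (M ⧸ K b) := fun b =>
    isArtinian_quotient_vanishingIdeal_pow (Set.finite_range _) _ M
  let images (N : Submodule A M) (H : Set.range 𝒟.stabilizer) :
      Submodule (MvPolynomial ι 𝕜) (M ⧸ K (pt H)) := (restrictAlong hM N).map (K (pt H)).mkQ
  have himages : StrictMono images := by
    intro N' N h
    have hle := (restrictAlong_strictMono hM h).le
    refine lt_of_le_not_ge (fun H => Submodule.map_mono hle) fun hge => ?_
    obtain ⟨b₀, hb₀⟩ := ρ.exists_forall_not_le_sup_orbitIdeal_smul hM h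
    let H : Set.range 𝒟.stabilizer := ⟨_, b₀, rfl⟩
    refine hb₀ (pt H) (hpt H).ge fun n hn => ?_
    obtain ⟨n', hn', hnn'⟩ := hge H (Submodule.mem_map_of_mem hn)
    rw [Submodule.mkQ_apply, Submodule.mkQ_apply, eq_comm, Submodule.Quotient.eq] at hnn'
    rw [← add_sub_cancel n' n]
    exact Submodule.add_mem_sup hn' (hk (pt H) N ⟨hnn', sub_mem hn (hle hn')⟩)
  exact himages.wellFoundedLT

theorem isFiniteLength [CharZero 𝕜] [IsAlgClosed 𝕜] [Finite G]
    [Module.Finite (MvPolynomial ι 𝕜) M] : IsFiniteLength A M := by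
  rw [isFiniteLength_iff_isNoetherian_isArtinian]
  exact ⟨isNoetherian_iff'.2 (restrictAlong_strictMono hM).wellFoundedGT, ρ.isArtinian hM⟩

end Realization

/-! ### Triangular decomposition -/

section Triangular

variable {𝕜 A : Type*} [CommSemiring 𝕜] [Semiring A] [Algebra 𝕜 A]

theorem one_mem_toSubmodule (B : Subalgebra 𝕜 A) : 1 ∈ toSubmodule B := one_mem B

theorem adjoin_le_of_mul_mem {s : Set A} {T : Submodule 𝕜 A} (hone : 1 ∈ T)
    (hmul : ∀ a ∈ s, ∀ b ∈ T, a * b ∈ T) : toSubmodule (Algebra.adjoin 𝕜 s) ≤ T := by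
  rw [Algebra.adjoin_eq_span, Submodule.span_le]
  intro a ha
  induction ha using Submonoid.closure_induction_left with
  | one => exact hone
  | mul_left a ha b _ hb => exact hmul a ha b hb

theorem mul_adjoin_le {L : Submodule 𝕜 A} {s : Set A}
    (h : L * Submodule.span 𝕜 s ≤ toSubmodule (Algebra.adjoin 𝕜 s) * L) :
    L * toSubmodule (Algebra.adjoin 𝕜 s) ≤ toSubmodule (Algebra.adjoin 𝕜 s) * L := by
  set X := toSubmodule (Algebra.adjoin 𝕜 s)
  refine Submodule.mul_le.2 fun l hl a ha => ?_
  have hL : ∀ l ∈ L, l ∈ X * L := fun l hl => by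
    simpa using Submodule.mul_mem_mul (one_mem_toSubmodule (Algebra.adjoin 𝕜 s)) hl
  induction ha using Algebra.adjoin_induction generalizing l with
  | mem a ha => exact h (Submodule.mul_mem_mul hl (Submodule.subset_span ha))
  | algebraMap r =>
    rw [← Algebra.commutes, ← Algebra.smul_def]
    exact Submodule.smul_mem _ r (hL l hl)
  | add a b _ _ ha hb => rw [mul_add]; exact add_mem (ha l hl) (hb l hl)
  | mul a b _ _ ha hb =>
    rw [← mul_assoc]
    refine Submodule.mul_induction_on (ha l hl) (fun c hc l' hl' => ?_) fun c d hc hd => ?_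
    · have := Submodule.mul_mem_mul hc (hb l' hl')
      rwa [← mul_assoc, ← mul_assoc, (Subalgebra.isIdempotentElem_toSubmodule _).eq] at this
    · rw [add_mul]; exact add_mem hc hd

theorem adjoin_mul_mul_adjoin_eq_top {s t : Set A} {W : Subalgebra 𝕜 A}
    (hWs : toSubmodule W * Submodule.span 𝕜 s ≤ toSubmodule (Algebra.adjoin 𝕜 s) * toSubmodule W)
    (htW : Submodule.span 𝕜 t * toSubmodule W ≤ toSubmodule W * toSubmodule (Algebra.adjoin 𝕜 t))
    (hts : Submodule.span 𝕜 t * Submodule.span 𝕜 s ≤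
      toSubmodule (Algebra.adjoin 𝕜 s) * (Submodule.span 𝕜 t ⊔ toSubmodule W))
    (hgen : Algebra.adjoin 𝕜 (s ∪ t ∪ W) = ⊤) :
    toSubmodule (Algebra.adjoin 𝕜 s) * toSubmodule W * toSubmodule (Algebra.adjoin 𝕜 t) = ⊤ := by
  set X := toSubmodule (Algebra.adjoin 𝕜 s)
  set Y := toSubmodule (Algebra.adjoin 𝕜 t)
  have hXX : X * X = X := (Subalgebra.isIdempotentElem_toSubmodule _).eq
  have hYY : Y * Y = Y := (Subalgebra.isIdempotentElem_toSubmodule _).eq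
  have hone : (1 : A) ∈ X * toSubmodule W * Y := by
    simpa using Submodule.mul_mem_mul
      (Submodule.mul_mem_mul (one_mem_toSubmodule (Algebra.adjoin 𝕜 s)) (one_mem_toSubmodule W))
      (one_mem_toSubmodule (Algebra.adjoin 𝕜 t))
  set L := Submodule.span 𝕜 t ⊔ toSubmodule W
  have hLX : L * X ≤ X * L := mul_adjoin_le <| by
    rw [Submodule.sup_mul]
    exact sup_le hts (hWs.trans (by gcongr; exact le_sup_right))
  have hLW : L * toSubmodule W ≤ toSubmodule W * Y := by
    rw [Submodule.sup_mul, (Subalgebra.isIdempotentElem_toSubmodule _).eq]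
    refine sup_le htW fun a ha => ?_
    simpa using Submodule.mul_mem_mul ha (one_mem_toSubmodule (Algebra.adjoin 𝕜 t))
  have hLT : L * (X * toSubmodule W * Y) ≤ X * toSubmodule W * Y :=
    calc L * (X * toSubmodule W * Y) = L * X * toSubmodule W * Y := by simp only [mul_assoc]
      _ ≤ X * L * toSubmodule W * Y := by gcongr
      _ = X * (L * toSubmodule W) * Y := by rw [mul_assoc X]
      _ ≤ X * (toSubmodule W * Y) * Y := by gcongr
      _ = X * toSubmodule W * Y := by rw [mul_assoc, mul_assoc, hYY, mul_assoc]
  have hXT : X * (X * toSubmodule W * Y) ≤ X * toSubmodule W * Y := by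
    rw [← mul_assoc, ← mul_assoc, hXX]
  refine top_unique ?_
  rw [← Algebra.top_toSubmodule, ← hgen]
  refine adjoin_le_of_mul_mem hone ?_
  rintro a ((ha | ha) | ha) b hb
  · exact hXT (Submodule.mul_mem_mul (Algebra.subset_adjoin ha) hb)
  · exact hLT (Submodule.mul_mem_mul (Submodule.mem_sup_left (Submodule.subset_span ha)) hb)
  · exact hLT (Submodule.mul_mem_mul (Submodule.mem_sup_right ha) hb)

end Triangular

/-! ### Products of submodules of an algebra and of a module -/

section SubmoduleProducts

variable {𝕜 A M : Type*} [CommRing 𝕜] [Ring A] [Algebra 𝕜 A] [AddCommGroup M] [Module 𝕜 M]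
  [Module A M] [IsScalarTower 𝕜 A M]

theorem fg_smul {I : Submodule 𝕜 A} {N : Submodule 𝕜 M} (hI : I.FG) (hN : N.FG) :
    (I • N).FG := by
  have : I • N = Submodule.map₂ (Algebra.lsmul 𝕜 𝕜 M).toLinearMap I N :=
    le_antisymm (Submodule.smul_le.2 fun a ha n hn =>
      Submodule.apply_mem_map₂ (Algebra.lsmul 𝕜 𝕜 M).toLinearMap ha hn)
      (Submodule.map₂_le.2 fun a ha n hn => Submodule.smul_mem_smul ha hn)
  rw [this]
  exact hI.map₂ _ hN

theorem mul_smul_submodule (I J : Submodule 𝕜 A) (N : Submodule 𝕜 M) : (I * J) • N = I • J • N :=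
  Submodule.smul_assoc I J N

theorem smul_smul_comm_of_commute {I J : Submodule 𝕜 A} (h : ∀ a ∈ I, ∀ b ∈ J, Commute a b)
    (N : Submodule 𝕜 M) : I • J • N = J • I • N := by
  rw [← mul_smul_submodule, ← mul_smul_submodule, Submodule.mul_comm_of_commute h]

theorem map_smul_map_smul_comm {B C : Type*} [Ring B] [Algebra 𝕜 B] [Ring C] [Algebra 𝕜 C]
    {φ : B →ₐ[𝕜] A} {ψ : C →ₐ[𝕜] A} (hcomm : ∀ b c, Commute (φ b) (ψ c)) (P : Submodule 𝕜 B)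
    (Q : Submodule 𝕜 C) (N : Submodule 𝕜 M) :
    P.map φ.toLinearMap • Q.map ψ.toLinearMap • N =
      Q.map ψ.toLinearMap • P.map φ.toLinearMap • N := by
  refine smul_smul_comm_of_commute ?_ N
  rintro _ ⟨b, -, rfl⟩ _ ⟨c, -, rfl⟩
  exact hcomm b c

theorem top_smul_span_eq_top {s : Set M} (hs : Submodule.span A s = ⊤) :
    (⊤ : Submodule 𝕜 A) • Submodule.span 𝕜 s = ⊤ := by
  refine top_unique fun m _ => ?_
  have hm : m ∈ Submodule.span A s := hs ▸ Submodule.mem_top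
  induction hm using Submodule.span_induction with
  | mem x hx =>
    simpa using Submodule.smul_mem_smul (Submodule.mem_top (x := (1 : A)))
      (Submodule.subset_span (R := 𝕜) hx)
  | zero => exact zero_mem _
  | add x y _ _ hx hy => exact add_mem (hx trivial) (hy trivial)
  | smul r x _ hx =>
    refine Submodule.smul_induction_on (hx trivial) (fun a _ v hv => ?_) fun a b ha hb => ?_
    · rw [smul_smul]
      exact Submodule.smul_mem_smul trivial hv
    · rw [smul_add]; exact add_mem ha hb

theorem adjoin_smul_le {s : Set A} {N : Submodule 𝕜 M} (h : ∀ a ∈ s, ∀ v ∈ N, a • v ∈ N) :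
    toSubmodule (Algebra.adjoin 𝕜 s) • N ≤ N := by
  refine Submodule.smul_le.2 fun a ha v hv => ?_
  induction ha using Algebra.adjoin_induction generalizing v with
  | mem a ha => exact h a ha v hv
  | algebraMap r => rw [algebraMap_smul]; exact N.smul_mem r hv
  | add a b _ _ ha hb => rw [add_smul]; exact add_mem (ha v hv) (hb v hv)
  | mul a b _ _ ha hb => rw [mul_smul]; exact ha _ (hb v hv)

theorem le_toSubmodule_smul (B : Subalgebra 𝕜 A) (N : Submodule 𝕜 M) :
    N ≤ toSubmodule B • N := fun v hv => by
  simpa using Submodule.smul_mem_smul (one_mem_toSubmodule B) hv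

theorem exists_pow_smul_eq_zero {d : A} (hd : ∀ m : M, ∃ n : ℕ, d ^ n • m = 0)
    {V : Submodule 𝕜 M} (hV : V.FG) : ∃ n : ℕ, ∀ v ∈ V, d ^ n • v = 0 := by
  obtain ⟨s, rfl⟩ := hV
  choose n hn using hd
  refine ⟨s.sup n, fun v hv => ?_⟩
  induction hv using Submodule.span_induction with
  | mem x hx =>
    rw [← Nat.sub_add_cancel (Finset.le_sup hx : n x ≤ s.sup n), pow_add, mul_smul, hn, smul_zero]
  | zero => exact smul_zero _
  | add x y _ _ hx hy => rw [smul_add, hx, hy, add_zero]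
  | smul r x _ hx => rw [smul_algebra_smul_comm, hx, smul_zero]

theorem fg_adjoin_singleton_smul {d : A} (hd : ∀ m : M, ∃ n : ℕ, d ^ n • m = 0)
    {V : Submodule 𝕜 M} (hV : V.FG) : (toSubmodule (Algebra.adjoin 𝕜 {d}) • V).FG := by
  obtain ⟨n, hn⟩ := exists_pow_smul_eq_zero hd hV
  have hpow : toSubmodule (Algebra.adjoin 𝕜 {d}) • V =
      Submodule.span 𝕜 ((fun k => d ^ k) '' Set.Iio n) • V := by
    refine le_antisymm ?_ (Submodule.smul_mono_left (Submodule.span_le.2 ?_))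
    · rw [Algebra.adjoin_eq_span, Submodule.smul_le]
      intro a ha v hv
      induction ha using Submodule.span_induction with
      | mem a ha =>
        obtain ⟨k, rfl⟩ := Submonoid.mem_closure_singleton.1 ha
        rcases lt_or_ge k n with hk | hk
        · exact Submodule.smul_mem_smul (Submodule.subset_span ⟨k, hk, rfl⟩) hv
        · rw [← Nat.sub_add_cancel hk, pow_add, mul_smul, hn v hv, smul_zero]
          exact zero_mem _
      | zero => rw [zero_smul]; exact zero_mem _
      | add a b _ _ ha hb => rw [add_smul]; exact add_mem ha hb
      | smul r a _ ha => rw [smul_assoc]; exact Submodule.smul_mem _ r ha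
    · rintro _ ⟨k, -, rfl⟩
      exact pow_mem (Algebra.self_mem_adjoin_singleton 𝕜 d) k
  rw [hpow]
  exact fg_smul (Submodule.fg_span ((Set.finite_Iio n).image _)) hV

/-- Commuting locally nilpotent elements are simultaneously locally finite. -/
theorem exists_fg_stable (s : Finset A) (hcomm : ∀ a ∈ s, ∀ b ∈ s, Commute a b)
    (hnil : ∀ a ∈ s, ∀ m : M, ∃ n : ℕ, a ^ n • m = 0) {V : Submodule 𝕜 M} (hV : V.FG) :
    ∃ V' : Submodule 𝕜 M, V ≤ V' ∧ V'.FG ∧ ∀ a ∈ s, ∀ v ∈ V', a • v ∈ V' := by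
  classical
  induction s using Finset.induction_on with
  | empty => exact ⟨V, le_rfl, hV, by simp⟩
  | insert d s _ ih =>
    obtain ⟨V', hVV', hV', hstable⟩ := ih
      (fun a ha b hb => hcomm a (Finset.mem_insert_of_mem ha) b (Finset.mem_insert_of_mem hb))
      fun a ha => hnil a (Finset.mem_insert_of_mem ha)
    set D := Algebra.adjoin 𝕜 {d}
    refine ⟨toSubmodule D • V', hVV'.trans (le_toSubmodule_smul D V'),
      fg_adjoin_singleton_smul (hnil d (Finset.mem_insert_self d s)) hV', fun a ha z hz => ?_⟩
    refine Submodule.smul_induction_on hz (fun b hb v hv => ?_) fun v v' hv hv' => ?_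
    · rcases Finset.mem_insert.1 ha with rfl | has
      · rw [smul_smul]
        exact Submodule.smul_mem_smul (mul_mem (S := Subalgebra 𝕜 A)
          (Algebra.self_mem_adjoin_singleton 𝕜 a) hb) hv
      · have hab : Commute a b := (Algebra.commute_of_mem_adjoin_singleton_of_commute hb
          (hcomm a ha d (Finset.mem_insert_self d s)))
        rw [smul_smul, hab.eq, mul_smul]
        exact Submodule.smul_mem_smul hb (hstable a has v hv)
    · rw [smul_add]; exact add_mem hv hv'

end SubmoduleProducts

/-! ### Subalgebras over which a commutative algebra is finite -/

section FiniteSubalgebra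

variable {𝕜 R : Type*} [Field 𝕜] [CommRing R] [Algebra 𝕜 R]

theorem exists_fg_mul_toSubmodule_eq_top (B : Subalgebra 𝕜 R) [Module.Finite B R] :
    ∃ F : Submodule 𝕜 R, F.FG ∧ F * toSubmodule B = ⊤ := by
  obtain ⟨s, hs⟩ := (inferInstance : Module.Finite B R).fg_top
  refine ⟨Submodule.span 𝕜 s, ⟨s, rfl⟩, top_unique fun p _ => ?_⟩
  have hp : p ∈ Submodule.span B (s : Set R) := hs ▸ Submodule.mem_top
  rw [mul_comm]
  induction hp using Submodule.span_induction with
  | mem x hx =>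
    simpa using Submodule.mul_mem_mul (one_mem_toSubmodule B) (Submodule.subset_span (R := 𝕜) hx)
  | zero => exact zero_mem _
  | add x y _ _ hx hy => exact add_mem (hx trivial) (hy trivial)
  | smul b x _ hx =>
    have := Submodule.mul_mem_mul (M := toSubmodule B) b.2 (hx trivial)
    rwa [← mul_assoc, (Subalgebra.isIdempotentElem_toSubmodule _).eq] at this

theorem fg_of_finite (B : Subalgebra 𝕜 R) [Module.Finite B R] [Algebra.FiniteType 𝕜 R] :
    B.FG := by
  rw [← Subalgebra.fg_top]
  exact fg_of_fg_of_fg 𝕜 B R Algebra.FiniteType.out Module.Finite.fg_top Subtype.val_injective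

variable {A M : Type*} [Ring A] [Algebra 𝕜 A] [AddCommGroup M] [Module 𝕜 M] [Module A M]
  [IsScalarTower 𝕜 A M] {φ ψ : R →ₐ[𝕜] A}

theorem map_adjoin_smul_map_adjoin_smul_le (hcomm : ∀ p q, Commute (φ p) (ψ q)) {s : Set R}
    {V : Submodule 𝕜 M} (hV : ∀ p ∈ s, ∀ v ∈ V, (φ p - ψ p) • v ∈ V) :
    toSubmodule ((Algebra.adjoin 𝕜 s).map φ) • toSubmodule ((Algebra.adjoin 𝕜 s).map ψ) • V ≤
      toSubmodule ((Algebra.adjoin 𝕜 s).map ψ) • V := by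
  rw [AlgHom.map_adjoin φ]
  refine adjoin_smul_le ?_
  rintro _ ⟨p, hp, rfl⟩ z hz
  refine Submodule.smul_induction_on hz ?_ fun v v' hv hv' => ?_
  · rintro _ ⟨q, hq, rfl⟩ v hv
    have : φ p • ψ q • v = ψ q • (φ p - ψ p) • v + ψ (q * p) • v := by
      rw [smul_smul, (hcomm p q).eq, mul_smul, sub_smul, smul_sub, map_mul, mul_smul,
        sub_add_cancel]
    exact this ▸ add_mem (Submodule.smul_mem_smul ⟨q, hq, rfl⟩ (hV p hp v hv))
      (Submodule.smul_mem_smul ⟨q * p, mul_mem hq (Algebra.subset_adjoin hp), rfl⟩ hv)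
  · rw [smul_add]; exact add_mem hv hv'

theorem toSubmodule_range_eq_map_mul_map {F : Submodule 𝕜 R} {B : Subalgebra 𝕜 R}
    (hFB : F * toSubmodule B = ⊤) (φ : R →ₐ[𝕜] A) :
    toSubmodule φ.range = F.map φ.toLinearMap * toSubmodule (B.map φ) := by
  rw [Subalgebra.map_toSubmodule, ← Submodule.map_mul, hFB, ← Algebra.map_top,
    Subalgebra.map_toSubmodule, Algebra.top_toSubmodule]

theorem range_smul_range_smul_le (hcomm : ∀ p q, Commute (φ p) (ψ q)) {F : Submodule 𝕜 R}
    {B : Subalgebra 𝕜 R} (hFB : F * toSubmodule B = ⊤) {V : Submodule 𝕜 M}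
    (hV : toSubmodule (B.map φ) • toSubmodule (B.map ψ) • V ≤ toSubmodule (B.map ψ) • V) :
    toSubmodule φ.range • toSubmodule ψ.range • V ≤
      toSubmodule ψ.range • F.map φ.toLinearMap • V := by
  have hφ := toSubmodule_range_eq_map_mul_map hFB φ
  have hψ := toSubmodule_range_eq_map_mul_map hFB ψ
  have hswap := map_smul_map_smul_comm (M := M) hcomm
  rw [Subalgebra.map_toSubmodule] at hV hφ hψ
  calc toSubmodule φ.range • toSubmodule ψ.range • V
    _ = F.map φ.toLinearMap • F.map ψ.toLinearMap •
          (toSubmodule B).map φ.toLinearMap • (toSubmodule B).map ψ.toLinearMap • V := by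
        rw [hφ, hψ, mul_smul_submodule, mul_smul_submodule, hswap]
    _ ≤ F.map φ.toLinearMap • F.map ψ.toLinearMap • (toSubmodule B).map ψ.toLinearMap • V := by
        gcongr
        exact hV
    _ = toSubmodule ψ.range • F.map φ.toLinearMap • V := by
        rw [hswap, hswap, hψ, mul_smul_submodule]

/-- On a finitely generated subspace stable under the operators `φ p - ψ p`, for generators `p` of
`B`, the action of `B` through `φ` can be replaced by the one through `ψ`. -/
theorem exists_fg_range_smul_range_smul_le [Algebra.FiniteType 𝕜 R] {B : Subalgebra 𝕜 R}
    [Module.Finite B R] (hcomm : ∀ p q, Commute (φ p) (ψ q))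
    (hnil : ∀ p ∈ B, ∀ m : M, ∃ n : ℕ, (φ p - ψ p) ^ n • m = 0)
    {V : Submodule 𝕜 M} (hV : V.FG) :
    ∃ V' : Submodule 𝕜 M, V'.FG ∧
      toSubmodule φ.range • toSubmodule ψ.range • V ≤ toSubmodule ψ.range • V' := by
  classical
  obtain ⟨F, hF, hFB⟩ := exists_fg_mul_toSubmodule_eq_top B
  obtain ⟨s, rfl⟩ := fg_of_finite B
  have hcomm_sub : ∀ p q, Commute (φ p - ψ p) (φ q - ψ q) := fun p q =>
    (((Commute.all p q).map φ).sub_right (hcomm p q)).sub_left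
      ((hcomm q p).symm.sub_right ((Commute.all p q).map ψ))
  obtain ⟨V', hVV', hV', hstable⟩ := exists_fg_stable (s.image fun p => φ p - ψ p)
    (by simp only [Finset.mem_image]; rintro _ ⟨p, -, rfl⟩ _ ⟨q, -, rfl⟩; exact hcomm_sub p q)
    (by
      simp only [Finset.mem_image]
      rintro _ ⟨p, hp, rfl⟩
      exact hnil p (Algebra.subset_adjoin hp)) hV
  refine ⟨F.map φ.toLinearMap • V', fg_smul (hF.map _) hV', ?_⟩
  calc toSubmodule φ.range • toSubmodule ψ.range • V
    _ ≤ toSubmodule φ.range • toSubmodule ψ.range • V' := by gcongr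
    _ ≤ toSubmodule ψ.range • F.map φ.toLinearMap • V' := range_smul_range_smul_le hcomm hFB <|
        map_adjoin_smul_map_adjoin_smul_le hcomm
          fun p hp => hstable _ (Finset.mem_image_of_mem _ hp)

end FiniteSubalgebra

/-! ### Invariant polynomials -/

namespace ReflectionDatum

variable {𝕜 ι G S : Type*} [Field 𝕜] [Fintype ι] [DecidableEq ι] [Group G]
  (𝒟 : ReflectionDatum 𝕜 ι G S)

/-- The algebra of invariant polynomials of a reflection datum. -/
def invariants : Subalgebra 𝕜 (MvPolynomial ι 𝕜) where
  carrier := {p | ∀ g, 𝒟.subst g p = p}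
  mul_mem' hp hq g := by rw [map_mul, hp g, hq g]
  add_mem' hp hq g := by rw [map_add, hp g, hq g]
  algebraMap_mem' a g := by rw [AlgHom.commutes]

instance finite_invariants [Finite G] : Module.Finite 𝒟.invariants (MvPolynomial ι 𝕜) := by
  let _ : MulSemiringAction G (MvPolynomial ι 𝕜) :=
    { smul := fun g p => 𝒟.subst g p
      one_smul := fun p => by
        change 𝒟.subst 1 p = p
        simp
      mul_smul := fun g h p => 𝒟.subst_mul_apply g h p
      smul_zero := fun g => map_zero (𝒟.subst g)
      smul_add := fun g => map_add (𝒟.subst g)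
      smul_one := fun g => map_one (𝒟.subst g)
      smul_mul := fun g => map_mul (𝒟.subst g) }
  have : Algebra.IsInvariant 𝒟.invariants (MvPolynomial ι 𝕜) G := ⟨fun p hp => ⟨⟨p, hp⟩, rfl⟩⟩
  have := Algebra.IsInvariant.isIntegral 𝒟.invariants (MvPolynomial ι 𝕜) G
  have : Algebra.FiniteType 𝒟.invariants (MvPolynomial ι 𝕜) :=
    Algebra.FiniteType.of_restrictScalars_finiteType 𝕜 _ _
  exact Algebra.IsIntegral.finite

end ReflectionDatum

/-! ### Modules finitely generated over the polynomials in the coordinates -/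

theorem Realization.isFiniteLength_of_fg {𝕜 ι G S : Type*} [Field 𝕜] [CharZero 𝕜]
    [IsAlgClosed 𝕜] [Fintype ι] [DecidableEq ι] [Group G] [Finite G] [Fintype S]
    {𝒟 : ReflectionDatum 𝕜 ι G S} {A : Type*} [Ring A] [Algebra 𝕜 A] (ρ : Realization 𝒟 A)
    {M : Type*} [AddCommGroup M] [Module 𝕜 M] [Module A M] [IsScalarTower 𝕜 A M]
    {V : Submodule 𝕜 M} (hV : V.FG) (h : toSubmodule ρ.poly.range • V = ⊤) :
    IsFiniteLength A M := by
  let _ : Module (MvPolynomial ι 𝕜) M := Module.compHom M ρ.poly.toRingHom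
  have hM : ∀ (p : MvPolynomial ι 𝕜) (m : M), p • m = ρ.poly p • m := fun _ _ => rfl
  have : IsScalarTower 𝕜 (MvPolynomial ι 𝕜) M := .of_algebraMap_smul fun r m => by
    rw [hM, AlgHom.commutes, algebraMap_smul]
  obtain ⟨s, rfl⟩ := hV
  have : Module.Finite (MvPolynomial ι 𝕜) M := by
    refine ⟨⟨s, top_unique fun m _ => ?_⟩⟩
    have hm : m ∈ toSubmodule ρ.poly.range • Submodule.span 𝕜 (s : Set M) :=
      h ▸ Submodule.mem_top
    refine Submodule.smul_induction_on hm ?_ fun a b ha hb => add_mem ha hb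
    rintro _ ⟨p, rfl⟩ v hv
    exact Submodule.smul_mem _ p (Submodule.span_le_restrictScalars 𝕜 _ _ hv)
  exact ρ.isFiniteLength hM

/-! ### Tensor products and opposites of realizations -/

section Tensor

variable {𝕜 ι G S ι' G' S' : Type*} [Field 𝕜] [Fintype ι] [DecidableEq ι] [Group G]
  [Fintype ι'] [DecidableEq ι'] [Group G']

/-- The product of two reflection data, acting on the direct sum of the two spaces. -/
def ReflectionDatum.prod (𝒟 : ReflectionDatum 𝕜 ι G S) (𝒟' : ReflectionDatum 𝕜 ι' G' S') :
    ReflectionDatum 𝕜 (ι ⊕ ι') (G × G') (S ⊕ S') where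
  mat :=
    { toFun := fun g => Matrix.fromBlocks (𝒟.mat g.1) 0 0 (𝒟'.mat g.2)
      map_one' := by simp [Matrix.fromBlocks_one]
      map_mul' := fun g h => by simp [Matrix.fromBlocks_multiply] }
  refl := Sum.elim (fun s => (𝒟.refl s, 1)) fun s => (1, 𝒟'.refl s)
  refl_inv := by rintro (s | s) <;> simp [ReflectionDatum.refl_inv]
  root := Sum.elim (fun s => Sum.elim (𝒟.root s) 0) fun s => Sum.elim 0 (𝒟'.root s)
  scale := Sum.elim 𝒟.scale 𝒟'.scale
  param := Sum.elim 𝒟.param 𝒟'.param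
  mat_refl := by
    rintro (s | s) <;> ext (i | i) (j | j) <;>
      simp [ReflectionDatum.mat_refl, Matrix.one_apply, Matrix.vecMulVec_apply]
  scale_root := by
    rintro (s | s) <;> simpa [dotProduct] using ReflectionDatum.scale_root _ s

variable {A B : Type*} [Ring A] [Algebra 𝕜 A] [Ring B] [Algebra 𝕜 B]

/-- The homomorphism `(g, g') ↦ w g ⊗ w' g'`. -/
def tensorHom (w : G →* A) (w' : G' →* B) : G × G' →* A ⊗[𝕜] B where
  toFun g := w g.1 ⊗ₜ w' g.2
  map_one' := by simp [Algebra.TensorProduct.one_def]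
  map_mul' g h := by simp

@[simp] theorem tensorHom_apply (w : G →* A) (w' : G' →* B) (g : G × G') :
    (tensorHom w w' g : A ⊗[𝕜] B) = w g.1 ⊗ₜ w' g.2 := rfl

variable [Fintype S] [Fintype S'] {𝒟 : ReflectionDatum 𝕜 ι G S} {𝒟' : ReflectionDatum 𝕜 ι' G' S'}

/-- The tensor product of two realizations, which realizes the product of the reflection data. -/
def Realization.tensor (ρ : Realization 𝒟 A) (ρ' : Realization 𝒟' B) :
    Realization (𝒟.prod 𝒟') (A ⊗[𝕜] B) where
  x := Sum.elim (fun i => ρ.x i ⊗ₜ 1) fun i => 1 ⊗ₜ ρ'.x i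
  y := Sum.elim (fun i => ρ.y i ⊗ₜ 1) fun i => 1 ⊗ₜ ρ'.y i
  w := tensorHom ρ.w ρ'.w
  x_comm := by
    rintro (i | i) (j | j)
    · simp [ρ.x_comm i j]
    · simp
    · simp
    · simp [ρ'.x_comm i j]
  w_x := by
    rintro ⟨g, h⟩ (j | j)
    · simp [ReflectionDatum.prod, ρ.w_x, TensorProduct.sum_tmul, ← TensorProduct.smul_tmul']
    · simp [ReflectionDatum.prod, ρ'.w_x, TensorProduct.tmul_sum]
  y_x := by
    rintro (i | i) (j | j)
    · simp only [Sum.elim_inl, Algebra.TensorProduct.tmul_mul_tmul, mul_one,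
        ← TensorProduct.sub_tmul, ρ.y_x]
      by_cases h : i = j <;>
        simp [ReflectionDatum.prod, h, TensorProduct.add_tmul, TensorProduct.sum_tmul,
          ← TensorProduct.smul_tmul', Algebra.TensorProduct.one_def]
    · simp [ReflectionDatum.prod]
    · simp [ReflectionDatum.prod]
    · simp only [Sum.elim_inr, Algebra.TensorProduct.tmul_mul_tmul, mul_one,
        ← TensorProduct.tmul_sub, ρ'.y_x]
      by_cases h : i = j <;>
        simp [ReflectionDatum.prod, h, TensorProduct.tmul_add, TensorProduct.tmul_sum,
          Algebra.TensorProduct.one_def]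

theorem Realization.range_poly_mul_range_poly_le (ρ : Realization 𝒟 A) (ρ' : Realization 𝒟' B) :
    toSubmodule (ρ.poly.range.map (Algebra.TensorProduct.includeLeft : A →ₐ[𝕜] A ⊗[𝕜] B)) *
        toSubmodule (ρ'.poly.range.map (Algebra.TensorProduct.includeRight : B →ₐ[𝕜] A ⊗[𝕜] B)) ≤
      toSubmodule (ρ.tensor ρ').poly.range := by
  have hleft : (Algebra.TensorProduct.includeLeft : A →ₐ[𝕜] A ⊗[𝕜] B).comp ρ.poly =
      (ρ.tensor ρ').poly.comp (rename Sum.inl) :=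
    algHom_ext fun i => by simp [Realization.tensor]
  have hright : (Algebra.TensorProduct.includeRight : B →ₐ[𝕜] A ⊗[𝕜] B).comp ρ'.poly =
      (ρ.tensor ρ').poly.comp (rename Sum.inr) :=
    algHom_ext fun i => by simp [Realization.tensor]
  rw [← AlgHom.range_comp, ← AlgHom.range_comp, hleft, hright,
    ← (Subalgebra.isIdempotentElem_toSubmodule (ρ.tensor ρ').poly.range).eq]
  exact mul_le_mul' (AlgHom.range_comp_le_range _ _) (AlgHom.range_comp_le_range _ _)

theorem range_includeLeft_mul_range_includeRight :
    toSubmodule (Algebra.TensorProduct.includeLeft : A →ₐ[𝕜] A ⊗[𝕜] B).range *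
      toSubmodule (Algebra.TensorProduct.includeRight : B →ₐ[𝕜] A ⊗[𝕜] B).range = ⊤ := by
  refine top_unique fun t _ => ?_
  induction t using TensorProduct.induction_on with
  | zero => exact zero_mem _
  | tmul a b =>
    have : a ⊗ₜ[𝕜] b = Algebra.TensorProduct.includeLeft (S := 𝕜) a *
        Algebra.TensorProduct.includeRight b := by simp
    exact this ▸ Submodule.mul_mem_mul ⟨a, rfl⟩ ⟨b, rfl⟩
  | add s t hs ht => exact add_mem (hs trivial) (ht trivial)

end Tensor

theorem range_op_comp {ι A : Type*} (z : ι → A) :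
    (Set.range fun i => MulOpposite.op (z i)) = MulOpposite.unop ⁻¹' Set.range z :=
  Set.ext fun _ => exists_congr fun _ => MulOpposite.unop_injective.eq_iff.symm

section Opposite

variable {𝕜 ι G S A : Type*} [Field 𝕜] [Group G] [Ring A] [Algebra 𝕜 A]

/-- The homomorphism `g ↦ w g⁻¹` to the opposite algebra. -/
def oppHom (w : G →* A) : G →* Aᵐᵒᵖ where
  toFun g := MulOpposite.op (w g⁻¹)
  map_one' := by simp
  map_mul' g h := by simp [← MulOpposite.op_mul]

@[simp] theorem oppHom_apply (w : G →* A) (g : G) : oppHom w g = MulOpposite.op (w g⁻¹) := rfl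

theorem range_oppHom (w : G →* A) :
    Set.range (oppHom w) = MulOpposite.unop ⁻¹' Set.range w := by
  ext a
  constructor
  · rintro ⟨g, rfl⟩
    exact ⟨g⁻¹, rfl⟩
  · rintro ⟨g, hg⟩
    exact ⟨g⁻¹, by rw [oppHom_apply, inv_inv, hg, MulOpposite.op_unop]⟩

theorem op_algHom_eq {φ : MvPolynomial ι 𝕜 →ₐ[𝕜] A} {ψ : MvPolynomial ι 𝕜 →ₐ[𝕜] Aᵐᵒᵖ}
    (h : ∀ i, ψ (X i) = MulOpposite.op (φ (X i))) (p : MvPolynomial ι 𝕜) :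
    ψ p = MulOpposite.op (φ p) := by
  induction p using MvPolynomial.induction_on with
  | C a => rw [MvPolynomial.algHom_C, MvPolynomial.algHom_C, MulOpposite.algebraMap_apply]
  | add p q hp hq => rw [map_add, map_add, hp, hq, MulOpposite.op_add]
  | mul_X p j hp => rw [map_mul, mul_comm p, map_mul, hp, h, MulOpposite.op_mul]

namespace ReflectionDatum

variable [Fintype ι] [DecidableEq ι] {𝒟 : ReflectionDatum 𝕜 ι G S} {w : G →* A} {z : ι → A}

theorem mul_w (h : ∀ g j, w g * z j = ∑ i, 𝒟.mat g i j • (z i * w g)) (g : G) (j : ι) :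
    z j * w g = ∑ i, 𝒟.mat g⁻¹ i j • (w g * z i) := by
  calc z j * w g = w g * (w g⁻¹ * z j) * w g := by
        rw [← mul_assoc, ← map_mul, mul_inv_cancel, map_one, one_mul]
    _ = ∑ i, 𝒟.mat g⁻¹ i j • (w g * z i * (w g⁻¹ * w g)) := by
        rw [h, Finset.mul_sum, Finset.sum_mul]
        simp only [mul_smul_comm, smul_mul_assoc, mul_assoc]
    _ = ∑ i, 𝒟.mat g⁻¹ i j • (w g * z i) := by
        rw [← map_mul, inv_mul_cancel, map_one]
        simp only [mul_one]

theorem oppHom_mul_op (h : ∀ g j, w g * z j = ∑ i, 𝒟.mat g i j • (z i * w g)) (g : G) (j : ι) :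
    oppHom w g * MulOpposite.op (z j) =
      ∑ i, 𝒟.mat g i j • (MulOpposite.op (z i) * oppHom w g) := by
  simp only [oppHom_apply, ← MulOpposite.op_mul, ← MulOpposite.op_smul, ← Finset.op_sum]
  rw [mul_w h, inv_inv]

theorem span_range_mul_span_range_comm
    (h : ∀ g j, w g * z j = ∑ i, 𝒟.mat g i j • (z i * w g)) :
    Submodule.span 𝕜 (Set.range w) * Submodule.span 𝕜 (Set.range z) =
      Submodule.span 𝕜 (Set.range z) * Submodule.span 𝕜 (Set.range w) := by
  apply le_antisymm
  · rw [Submodule.span_mul_span, Submodule.span_le]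
    rintro _ ⟨_, ⟨g, rfl⟩, _, ⟨j, rfl⟩, rfl⟩
    change w g * z j ∈ _
    rw [h]
    exact sum_mem fun i _ => Submodule.smul_mem _ _ <|
      Submodule.mul_mem_mul (Submodule.subset_span ⟨i, rfl⟩) (Submodule.subset_span ⟨g, rfl⟩)
  · rw [Submodule.span_mul_span, Submodule.span_le]
    rintro _ ⟨_, ⟨j, rfl⟩, _, ⟨g, rfl⟩, rfl⟩
    change z j * w g ∈ _
    rw [mul_w h]
    exact sum_mem fun i _ => Submodule.smul_mem _ _ <|
      Submodule.mul_mem_mul (Submodule.subset_span ⟨g, rfl⟩) (Submodule.subset_span ⟨i, rfl⟩)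

end ReflectionDatum

end Opposite

/-! ### Bimodules over algebras with a triangular decomposition -/

theorem sub_pow_smul_eq_zero_comm {A M : Type*} [Ring A] [AddCommGroup M] [Module A M] {a b : A}
    {n : ℕ} {m : M} (h : (a - b) ^ n • m = 0) : (b - a) ^ n • m = 0 := by
  rw [← neg_sub, neg_pow, mul_smul, h, smul_zero]

section Bimodule

variable {𝕜 A B T M : Type*} [CommRing 𝕜] [Ring A] [Algebra 𝕜 A] [Ring B] [Algebra 𝕜 B]
  [Ring T] [Algebra 𝕜 T] [AddCommGroup M] [Module 𝕜 M] [Module T M] [IsScalarTower 𝕜 T M]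

/-- A triangular decomposition of an algebra, in both orders of the outer factors. -/
structure IsTriangular (X W Y : Subalgebra 𝕜 A) : Prop where
  mul_mul_eq_top : toSubmodule X * toSubmodule W * toSubmodule Y = ⊤
  mul_mul_eq_top_symm : toSubmodule Y * toSubmodule W * toSubmodule X = ⊤
  mul_le : toSubmodule W * toSubmodule X ≤ toSubmodule X * toSubmodule W

theorem IsTriangular.map_mul_map_le {X W Y : Subalgebra 𝕜 A} (h : IsTriangular X W Y)
    (L : A →ₐ[𝕜] T) :
    toSubmodule (W.map L) * toSubmodule (X.map L) ≤
      toSubmodule (X.map L) * toSubmodule (W.map L) := by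
  simp only [Subalgebra.map_toSubmodule, ← Submodule.map_mul]
  exact Submodule.map_mono h.mul_le

theorem toSubmodule_range_eq_of_mul_mul_eq_top (L : A →ₐ[𝕜] T) {X W Y : Subalgebra 𝕜 A}
    (h : toSubmodule X * toSubmodule W * toSubmodule Y = ⊤) :
    toSubmodule L.range =
      toSubmodule (X.map L) * toSubmodule (W.map L) * toSubmodule (Y.map L) := by
  simp only [Subalgebra.map_toSubmodule]
  rw [← Submodule.map_mul, ← Submodule.map_mul, h, ← Algebra.map_top, Subalgebra.map_toSubmodule,
    Algebra.top_toSubmodule]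

/-- The hypotheses `hY` and `hX` allow to trade the right action of `Y'` for the left action of `X`
and the left action of `Y` for the right action of `X'`, at the cost of enlarging `V`. -/
theorem exists_fg_mul_smul_eq_top {L : A →ₐ[𝕜] T} {R : B →ₐ[𝕜] T}
    (hLR : ∀ a b, Commute (L a) (R b)) (hgen : toSubmodule L.range * toSubmodule R.range = ⊤)
    {X W Y : Subalgebra 𝕜 A} {X' W' Y' : Subalgebra 𝕜 B} (h : IsTriangular X W Y)
    (h' : IsTriangular X' W' Y') (hW : (toSubmodule W).FG) (hW' : (toSubmodule W').FG)
    (hY : ∀ V : Submodule 𝕜 M, V.FG → ∃ V' : Submodule 𝕜 M, V'.FG ∧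
      toSubmodule (Y.map L) • toSubmodule (X'.map R) • V ≤ toSubmodule (X'.map R) • V')
    (hX : ∀ V : Submodule 𝕜 M, V.FG → ∃ V' : Submodule 𝕜 M, V'.FG ∧
      toSubmodule (Y'.map R) • toSubmodule (X.map L) • V ≤ toSubmodule (X.map L) • V')
    {V : Submodule 𝕜 M} (hV : V.FG) (hVtop : (⊤ : Submodule 𝕜 T) • V = ⊤) :
    ∃ V' : Submodule 𝕜 M, V'.FG ∧
      (toSubmodule (X.map L) * toSubmodule (X'.map R)) • V' = ⊤ := by
  have hcomm : ∀ (P : Subalgebra 𝕜 A) (Q : Subalgebra 𝕜 B) (N : Submodule 𝕜 M),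
      toSubmodule (P.map L) • toSubmodule (Q.map R) • N =
        toSubmodule (Q.map R) • toSubmodule (P.map L) • N := fun P Q =>
    map_smul_map_smul_comm hLR (toSubmodule P) (toSubmodule Q)
  have hL := toSubmodule_range_eq_of_mul_mul_eq_top L h.mul_mul_eq_top
  have hR := toSubmodule_range_eq_of_mul_mul_eq_top R h'.mul_mul_eq_top
  have hR' := toSubmodule_range_eq_of_mul_mul_eq_top R h'.mul_mul_eq_top_symm
  have hWX := h.map_mul_map_le L
  have hXX := (Subalgebra.isIdempotentElem_toSubmodule (X.map L)).eq
  obtain ⟨V₁, hV₁, h₁⟩ := hY V hV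
  obtain ⟨V₂, hV₂, h₂⟩ := hX V₁ hV₁
  refine ⟨toSubmodule (W.map L) • toSubmodule (W'.map R) • V₂,
    fg_smul (hW.map L.toLinearMap) (fg_smul (hW'.map R.toLinearMap) hV₂), top_unique ?_⟩
  have hle : V₁ ≤ toSubmodule (X.map L) • V₁ := le_toSubmodule_smul _ _
  set Xl := toSubmodule (X.map L)
  set Wl := toSubmodule (W.map L)
  set Yl := toSubmodule (Y.map L)
  set Xr := toSubmodule (X'.map R)
  set Wr := toSubmodule (W'.map R)
  set Yr := toSubmodule (Y'.map R)
  calc (⊤ : Submodule 𝕜 M) = Xl • Wl • Yl • Yr • Wr • Xr • V := by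
        rw [← hVtop, ← hgen, hL, hR']
        simp only [mul_smul_submodule]
    _ = Xl • Wl • Yr • Wr • Yl • Xr • V := by rw [hcomm Y, hcomm Y]
    _ ≤ Xl • Wl • Yr • Wr • Xr • V₁ := by gcongr
    _ = Xl • Wl • Xr • Wr • Yr • V₁ := by
        rw [← mul_smul_submodule Wr, ← mul_smul_submodule Yr, ← mul_assoc, ← hR', hR]
        simp only [mul_smul_submodule]
    _ ≤ Xl • Wl • Xr • Wr • Yr • Xl • V₁ := by gcongr
    _ ≤ Xl • Wl • Xr • Wr • Xl • V₂ := by gcongr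
    _ = Xl • (Wl * Xl) • Xr • Wr • V₂ := by rw [← hcomm X, ← hcomm X, mul_smul_submodule]
    _ ≤ Xl • (Xl * Wl) • Xr • Wr • V₂ := smul_mono_right _ (Submodule.smul_mono_left hWX)
    _ = (Xl * Xl) • Wl • Xr • Wr • V₂ := by simp only [mul_smul_submodule]
    _ = (Xl * Xr) • Wl • Wr • V₂ := by rw [hXX, hcomm W, mul_smul_submodule]

end Bimodule

/-! ### Realizations with commuting momenta -/

/-- A realization in an algebra generated by it, in which also the momenta commute and transform
like the coordinates. -/
structure FullRealization {𝕜 ι G S : Type*} [Field 𝕜] [Fintype ι] [DecidableEq ι] [Group G]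
    [Fintype S] (𝒟 : ReflectionDatum 𝕜 ι G S) (A : Type*) [Ring A] [Algebra 𝕜 A]
    extends Realization 𝒟 A where
  y_comm : ∀ i j, y i * y j = y j * y i
  w_y : ∀ g j, w g * y j = ∑ i, 𝒟.mat g i j • (y i * w g)
  adjoin_eq_top : Algebra.adjoin 𝕜 (Set.range x ∪ Set.range y ∪ Set.range w) = ⊤

theorem range_eq_adjoin {𝕜 ι A : Type*} [CommSemiring 𝕜] [Semiring A] [Algebra 𝕜 A]
    (φ : MvPolynomial ι 𝕜 →ₐ[𝕜] A) :
    φ.range = Algebra.adjoin 𝕜 (Set.range fun i => φ (X i)) := by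
  rw [← Algebra.map_top, ← adjoin_range_X, AlgHom.map_adjoin, ← Set.range_comp]
  rfl

theorem toSubmodule_adjoin_range_eq_span {𝕜 G A : Type*} [CommSemiring 𝕜] [Group G] [Semiring A]
    [Algebra 𝕜 A] (w : G →* A) :
    toSubmodule (Algebra.adjoin 𝕜 (Set.range w)) = Submodule.span 𝕜 (Set.range w) := by
  rw [Algebra.adjoin_eq_span, ← MonoidHom.coe_mrange, Submonoid.closure_eq]

theorem ReflectionDatum.adjoin_mul_adjoin_mul_adjoin_eq_top {𝕜 ι G S A : Type*} [Field 𝕜]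
    [Fintype ι] [DecidableEq ι] [Group G] [Ring A] [Algebra 𝕜 A] {𝒟 : ReflectionDatum 𝕜 ι G S}
    {w : G →* A} {z z' : ι → A} (hz : ∀ g j, w g * z j = ∑ i, 𝒟.mat g i j • (z i * w g))
    (hz' : ∀ g j, w g * z' j = ∑ i, 𝒟.mat g i j • (z' i * w g))
    (hsub : ∀ i j, z' i * z j - z j * z' i ∈ Algebra.adjoin 𝕜 (Set.range w))
    (hgen : Algebra.adjoin 𝕜 (Set.range z ∪ Set.range z' ∪ Set.range w) = ⊤) :
    toSubmodule (Algebra.adjoin 𝕜 (Set.range z)) * toSubmodule (Algebra.adjoin 𝕜 (Set.range w)) *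
      toSubmodule (Algebra.adjoin 𝕜 (Set.range z')) = ⊤ := by
  have hle : ∀ u : ι → A, Submodule.span 𝕜 (Set.range u) ≤
      toSubmodule (Algebra.adjoin 𝕜 (Set.range u)) := fun u => Algebra.span_le_adjoin 𝕜 _
  refine adjoin_mul_mul_adjoin_eq_top ?_ ?_ ?_ (top_unique (hgen ▸ Algebra.adjoin_mono
    (Set.union_subset_union_right _ Algebra.subset_adjoin)))
  · rw [toSubmodule_adjoin_range_eq_span w, span_range_mul_span_range_comm hz]
    gcongr
    exact hle z
  · rw [toSubmodule_adjoin_range_eq_span w, ← span_range_mul_span_range_comm hz']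
    gcongr
    exact hle z'
  · rw [Submodule.span_mul_span, Submodule.span_le]
    rintro _ ⟨_, ⟨i, rfl⟩, _, ⟨j, rfl⟩, rfl⟩
    change z' i * z j ∈ _
    rw [← add_sub_cancel (z j * z' i) (z' i * z j)]
    refine add_mem (Submodule.mul_mem_mul (hle z (Submodule.subset_span ⟨j, rfl⟩))
      (Submodule.mem_sup_left (Submodule.subset_span ⟨i, rfl⟩))) ?_
    simpa using Submodule.mul_mem_mul (one_mem_toSubmodule (Algebra.adjoin 𝕜 (Set.range z)))
      (Submodule.mem_sup_right (hsub i j))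

namespace FullRealization

variable {𝕜 ι G S A : Type*} [Field 𝕜] [Fintype ι] [DecidableEq ι] [Group G] [Fintype S]
  {𝒟 : ReflectionDatum 𝕜 ι G S} [Ring A] [Algebra 𝕜 A] (ρ : FullRealization 𝒟 A)

/-- The homomorphism evaluating polynomials at the momenta of a realization. -/
def ypoly : MvPolynomial ι 𝕜 →ₐ[𝕜] A := (exists_algHom_of_commute ρ.y_comm).choose

@[simp] theorem ypoly_X (i : ι) : ρ.ypoly (X i) = ρ.y i :=
  (exists_algHom_of_commute ρ.y_comm).choose_spec i

theorem w_mul_ypoly (g : G) (p : MvPolynomial ι 𝕜) :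
    ρ.w g * ρ.ypoly p = ρ.ypoly (𝒟.subst g p) * ρ.w g :=
  𝒟.mul_algHom_eq (fun j => by simpa using ρ.w_y g j) p

/-- The image of the group algebra. -/
def groupSubalgebra : Subalgebra 𝕜 A := Algebra.adjoin 𝕜 (Set.range ρ.w)

theorem toSubmodule_groupSubalgebra :
    toSubmodule ρ.groupSubalgebra = Submodule.span 𝕜 (Set.range ρ.w) :=
  toSubmodule_adjoin_range_eq_span ρ.w

theorem fg_groupSubalgebra [Finite G] : (toSubmodule ρ.groupSubalgebra).FG := by
  rw [toSubmodule_groupSubalgebra]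
  exact Submodule.fg_span (Set.finite_range _)

theorem range_poly : ρ.poly.range = Algebra.adjoin 𝕜 (Set.range ρ.x) := by
  simp only [range_eq_adjoin, Realization.poly_X]

theorem range_ypoly : ρ.ypoly.range = Algebra.adjoin 𝕜 (Set.range ρ.y) := by
  simp only [range_eq_adjoin, ypoly_X]

theorem y_mul_x_sub_mem (i j : ι) : ρ.y i * ρ.x j - ρ.x j * ρ.y i ∈ ρ.groupSubalgebra := by
  rw [ρ.y_x]
  refine add_mem ?_ (sum_mem fun s _ =>
    Subalgebra.smul_mem _ (Algebra.subset_adjoin (Set.mem_range_self _)) _)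
  split_ifs
  · exact one_mem _
  · exact zero_mem _

theorem isTriangular : IsTriangular ρ.poly.range ρ.groupSubalgebra ρ.ypoly.range where
  mul_mul_eq_top := by
    rw [range_poly, range_ypoly]
    exact ReflectionDatum.adjoin_mul_adjoin_mul_adjoin_eq_top ρ.w_x ρ.w_y ρ.y_mul_x_sub_mem
      ρ.adjoin_eq_top
  mul_mul_eq_top_symm := by
    rw [range_poly, range_ypoly]
    refine ReflectionDatum.adjoin_mul_adjoin_mul_adjoin_eq_top ρ.w_y ρ.w_x (fun i j => ?_) ?_
    · rw [← neg_sub]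
      exact neg_mem (ρ.y_mul_x_sub_mem j i)
    · rw [Set.union_comm (Set.range ρ.y)]
      exact ρ.adjoin_eq_top
  mul_le := by
    rw [range_poly]
    refine mul_adjoin_le ?_
    rw [toSubmodule_groupSubalgebra, ReflectionDatum.span_range_mul_span_range_comm ρ.w_x]
    gcongr
    exact Algebra.span_le_adjoin 𝕜 _

theorem adjoin_op_eq_top :
    Algebra.adjoin 𝕜 ((Set.range fun i => MulOpposite.op (ρ.y i)) ∪
      (Set.range fun i => MulOpposite.op (ρ.x i)) ∪ Set.range (oppHom ρ.w)) = ⊤ := by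
  rw [range_op_comp, range_op_comp, range_oppHom, ← Set.preimage_union, ← Set.preimage_union,
    Set.union_comm (Set.range ρ.y), ← Subalgebra.op_adjoin, ρ.adjoin_eq_top, Subalgebra.op_top]

open MulOpposite in
/-- The realization in the opposite algebra for which coordinates and momenta are exchanged. -/
def opp : FullRealization 𝒟 Aᵐᵒᵖ where
  x i := op (ρ.y i)
  y i := op (ρ.x i)
  w := oppHom ρ.w
  x_comm i j := by rw [← op_mul, ← op_mul, ρ.y_comm]
  y_comm i j := by rw [← op_mul, ← op_mul, ρ.x_comm]
  w_x := ReflectionDatum.oppHom_mul_op ρ.w_y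
  w_y := ReflectionDatum.oppHom_mul_op ρ.w_x
  y_x i j := by
    rw [← op_mul, ← op_mul, ← op_sub, ρ.y_x]
    simp only [eq_comm (a := j), op_add, apply_ite op, op_one, op_zero, Finset.op_sum, op_smul,
      oppHom_apply, 𝒟.refl_inv, mul_right_comm _ (𝒟.root _ j)]
  adjoin_eq_top := ρ.adjoin_op_eq_top

theorem opp_poly (p : MvPolynomial ι 𝕜) : ρ.opp.poly p = MulOpposite.op (ρ.ypoly p) :=
  op_algHom_eq (fun i => by rw [Realization.poly_X, ypoly_X]; rfl) p

theorem opp_ypoly (p : MvPolynomial ι 𝕜) : ρ.opp.ypoly p = MulOpposite.op (ρ.poly p) :=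
  op_algHom_eq (fun i => by rw [Realization.poly_X, ypoly_X]; rfl) p

section Modules

variable [CharZero 𝕜] [IsAlgClosed 𝕜] [Finite G] {M : Type*} [AddCommGroup M] [Module 𝕜 M]

theorem isFiniteLength_of_stable [Module A M] [IsScalarTower 𝕜 A M] {V : Submodule 𝕜 M}
    (hV : V.FG) (hgen : (⊤ : Submodule 𝕜 A) • V = ⊤)
    (hstable : ∀ p ∈ 𝒟.invariants, ∀ v ∈ V, ρ.ypoly p • v ∈ V) : IsFiniteLength A M := by
  obtain ⟨F, hF, hFI⟩ := exists_fg_mul_toSubmodule_eq_top 𝒟.invariants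
  have hinv : toSubmodule (𝒟.invariants.map ρ.ypoly) • V ≤ V := by
    refine Submodule.smul_le.2 ?_
    rintro _ ⟨p, hp, rfl⟩ v hv
    exact hstable p hp v hv
  refine ρ.toRealization.isFiniteLength_of_fg
    (fg_smul ρ.fg_groupSubalgebra (fg_smul (hF.map ρ.ypoly.toLinearMap) hV)) (top_unique ?_)
  calc (⊤ : Submodule 𝕜 M)
    _ = toSubmodule ρ.poly.range • toSubmodule ρ.groupSubalgebra •
          F.map ρ.ypoly.toLinearMap • toSubmodule (𝒟.invariants.map ρ.ypoly) • V := by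
        rw [← hgen, ← ρ.isTriangular.mul_mul_eq_top,
          toSubmodule_range_eq_map_mul_map hFI ρ.ypoly]
        simp only [mul_smul_submodule]
    _ ≤ toSubmodule ρ.poly.range • toSubmodule ρ.groupSubalgebra •
          F.map ρ.ypoly.toLinearMap • V := by gcongr

theorem isFiniteLength_bimodule [Module (A ⊗[𝕜] Aᵐᵒᵖ) M] [IsScalarTower 𝕜 (A ⊗[𝕜] Aᵐᵒᵖ) M]
    [Module.Finite (A ⊗[𝕜] Aᵐᵒᵖ) M]
    (hx : ∀ p ∈ 𝒟.invariants, ∀ m : M, ∃ n : ℕ,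
      (ρ.poly p ⊗ₜ[𝕜] 1 - 1 ⊗ₜ[𝕜] MulOpposite.op (ρ.poly p) : A ⊗[𝕜] Aᵐᵒᵖ) ^ n • m = 0)
    (hy : ∀ p ∈ 𝒟.invariants, ∀ m : M, ∃ n : ℕ,
      (ρ.ypoly p ⊗ₜ[𝕜] 1 - 1 ⊗ₜ[𝕜] MulOpposite.op (ρ.ypoly p) : A ⊗[𝕜] Aᵐᵒᵖ) ^ n • m = 0) :
    IsFiniteLength (A ⊗[𝕜] Aᵐᵒᵖ) M := by
  let L : A →ₐ[𝕜] A ⊗[𝕜] Aᵐᵒᵖ := Algebra.TensorProduct.includeLeft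
  let R : Aᵐᵒᵖ →ₐ[𝕜] A ⊗[𝕜] Aᵐᵒᵖ := Algebra.TensorProduct.includeRight
  have hLR : ∀ a b, Commute (L a) (R b) := fun a b =>
    (Commute.one_right a).tmul (Commute.one_left b)
  obtain ⟨s, hs⟩ := Module.Finite.fg_top (R := A ⊗[𝕜] Aᵐᵒᵖ) (M := M)
  obtain ⟨V, hV, hVtop⟩ := exists_fg_mul_smul_eq_top hLR range_includeLeft_mul_range_includeRight
    ρ.isTriangular ρ.opp.isTriangular ρ.fg_groupSubalgebra ρ.opp.fg_groupSubalgebra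
    (fun V hV => by
      simp only [← AlgHom.range_comp]
      refine exists_fg_range_smul_range_smul_le (B := 𝒟.invariants) (fun p q => hLR _ _)
        (fun p hp => ?_) hV
      simp only [AlgHom.comp_apply, opp_poly]
      exact hy p hp)
    (fun V hV => by
      simp only [← AlgHom.range_comp]
      refine exists_fg_range_smul_range_smul_le (B := 𝒟.invariants) (fun p q => (hLR _ _).symm)
        (fun p hp m => (hx p hp m).imp fun n hn => ?_) hV
      simp only [AlgHom.comp_apply, opp_ypoly]
      exact sub_pow_smul_eq_zero_comm hn)
    ⟨s, rfl⟩ (top_smul_span_eq_top hs)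
  refine (ρ.toRealization.tensor ρ.opp.toRealization).isFiniteLength_of_fg hV (top_unique ?_)
  rw [← hVtop]
  exact Submodule.smul_mono_left
    (ρ.toRealization.range_poly_mul_range_poly_le ρ.opp.toRealization)

end Modules

end FullRealization

/-! ### Orthonormal coordinates on the reflection representation -/

section Coordinates

variable {E : Type*} [NormedAddCommGroup E] [InnerProductSpace ℝ E]

@[simp] theorem rootForm_tmul (v : E) (z : ℂ) (u : E) :
    rootForm v (z ⊗ₜ[ℝ] u) = z * (inner ℝ v u : ℝ) := by
  simp [rootForm, Algebra.smul_def, mul_comm]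

theorem act_tmul (g : E ≃ₗᵢ[ℝ] E) (z : ℂ) (u : E) : act g (z ⊗ₜ[ℝ] u) = z ⊗ₜ[ℝ] g u := rfl

theorem actDual_rootForm (g : E ≃ₗᵢ[ℝ] E) (v : E) : actDual g (rootForm v) = rootForm (g v) := by
  apply TensorProduct.AlgebraTensorModule.ext
  intro z u
  have hg : inner ℝ v (g.symm u) = inner ℝ (g v) u := by
    rw [← g.inner_map_map v (g.symm u), g.apply_symm_apply]
  rw [rootForm_tmul, ← hg, ← rootForm_tmul]
  rfl

theorem reflection_orthogonal_singleton_apply (v u : E) : (ℝ ∙ v)ᗮ.reflection u =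
    u - (2 / inner ℝ v v * inner ℝ v u) • v := by
  rw [Submodule.reflection_orthogonal_apply, Submodule.reflection_singleton_apply, neg_sub,
    ← Nat.cast_smul_eq_nsmul ℝ, smul_smul, real_inner_self_eq_norm_sq, RCLike.ofReal_real_eq_id,
    id_eq, Nat.cast_ofNat, mul_div_assoc', div_mul_eq_mul_div]

variable {ι : Type*} [Fintype ι] (e : OrthonormalBasis ι ℝ E)

/-- The complexification of an orthonormal basis. -/
def cplxBasis : Module.Basis ι ℂ (Cplx E) := e.toBasis.baseChange ℂ

theorem cplxBasis_apply (i : ι) : cplxBasis e i = 1 ⊗ₜ[ℝ] e i := by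
  rw [cplxBasis, Module.Basis.baseChange_apply, e.coe_toBasis]

theorem coord_cplxBasis (i : ι) : (cplxBasis e).coord i = rootForm (e i) := by
  classical
  refine (cplxBasis e).ext fun j => ?_
  rw [Module.Basis.coord_apply, Module.Basis.repr_self, Finsupp.single_apply, cplxBasis_apply,
    rootForm_tmul, e.inner_eq_ite]
  simp [eq_comm, apply_ite Complex.ofReal]

theorem span_range_one_tmul : Submodule.span ℂ (Set.range fun i => (1 : ℂ) ⊗ₜ[ℝ] e i) = ⊤ := by
  simp only [← cplxBasis_apply]
  exact (cplxBasis e).span_eq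

theorem span_range_rootForm : Submodule.span ℂ (Set.range fun i => rootForm (e i)) = ⊤ := by
  classical
  simp only [← coord_cplxBasis]
  rw [← (cplxBasis e).coe_dualBasis]
  exact (cplxBasis e).dualBasis.span_eq

/-- The coordinates of a vector in an orthonormal basis, as complex numbers. -/
def coords (v : E) (i : ι) : ℂ := (inner ℝ (e i) v : ℝ)

theorem coords_dotProduct_coords (u v : E) : coords e u ⬝ᵥ coords e v = (inner ℝ u v : ℝ) := by
  simp only [dotProduct, coords, ← Complex.ofReal_mul, ← Complex.ofReal_sum,
    real_inner_comm u (e _), e.sum_inner_mul_inner]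

theorem one_tmul_eq_sum (v : E) :
    (1 : ℂ) ⊗ₜ[ℝ] v = ∑ i, coords e v i • ((1 : ℂ) ⊗ₜ[ℝ] e i) := by
  conv_lhs => rw [← (cplxBasis e).sum_repr ((1 : ℂ) ⊗ₜ[ℝ] v)]
  simp only [cplxBasis_apply, ← Module.Basis.coord_apply, coord_cplxBasis, rootForm_tmul, one_mul,
    coords]

theorem rootForm_eq_sum (v : E) : rootForm v = ∑ i, coords e v i • rootForm (e i) := by
  conv_lhs => rw [← (cplxBasis e).sum_dual_apply_smul_coord (rootForm v)]
  simp only [cplxBasis_apply, coord_cplxBasis, rootForm_tmul, one_mul, coords,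
    real_inner_comm v (e _)]

variable [DecidableEq ι]

/-- The complex matrix of an isometry in an orthonormal basis. -/
def isometryMatrix : (E ≃ₗᵢ[ℝ] E) →* Matrix ι ι ℂ where
  toFun g := Matrix.of fun i j => coords e (g (e j)) i
  map_one' := by
    ext i j
    simp [coords, Matrix.one_apply, e.inner_eq_ite, apply_ite Complex.ofReal]
  map_mul' g h := by
    ext i j
    have hsum := congrArg (fun v => coords e (g v) i) (e.sum_repr' (h (e j))).symm
    simpa [Matrix.mul_apply, coords, inner_sum, inner_smul_right, mul_comm] using hsum

theorem isometryMatrix_apply (g : E ≃ₗᵢ[ℝ] E) (i j : ι) :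
    isometryMatrix e g i j = coords e (g (e j)) i := rfl

theorem isometryMatrix_reflection (v : E) : isometryMatrix e (ℝ ∙ v)ᗮ.reflection =
    1 - ((2 / inner ℝ v v : ℝ) : ℂ) • Matrix.vecMulVec (coords e v) (coords e v) := by
  ext i j
  simp only [isometryMatrix_apply, coords, reflection_orthogonal_singleton_apply, inner_sub_right,
    inner_smul_right, e.inner_eq_ite, real_inner_comm (e j) v, Matrix.sub_apply, Matrix.one_apply,
    Matrix.smul_apply, Matrix.vecMulVec_apply, smul_eq_mul]
  split_ifs <;> push_cast <;> ring

end Coordinates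

/-! ### The rational Cherednik algebra -/

section Algebra

variable {E : Type*} [NormedAddCommGroup E] [InnerProductSpace ℝ E]
  (W : Subgroup (E ≃ₗᵢ[ℝ] E)) (α : reflections W → E) (c : reflections W → ℂ)

/-- The quotient map from the free algebra. -/
def mk : FreeAlgebra ℂ (Gen W) →ₐ[ℂ] Cherednik W α c := RingQuot.mkAlgHom ℂ (Rel W α c)

theorem mk_gen (g : Gen W) : mk W α c (gen W g) = of W α c g := rfl

variable {W α c} in
theorem Rel.mk_eq {a b : FreeAlgebra ℂ (Gen W)} (h : Rel W α c a b) : mk W α c a = mk W α c b :=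
  RingQuot.mkAlgHom_rel ℂ h

/-- The linear map from `𝔥*` to the algebra. -/
def ofX : CplxDual E →ₗ[ℂ] Cherednik W α c where
  toFun x := of W α c (.x x)
  map_add' x x' := by simpa only [map_add, mk_gen] using (Rel.x_add x x').mk_eq
  map_smul' a x := by simpa only [map_smul, mk_gen, RingHom.id_apply] using (Rel.x_smul a x).mk_eq

/-- The linear map from `𝔥` to the algebra. -/
def ofY : Cplx E →ₗ[ℂ] Cherednik W α c where
  toFun y := of W α c (.y y)
  map_add' y y' := by simpa only [map_add, mk_gen] using (Rel.y_add y y').mk_eq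
  map_smul' a y := by simpa only [map_smul, mk_gen, RingHom.id_apply] using (Rel.y_smul a y).mk_eq

/-- The group homomorphism from `W` to the algebra. -/
def ofW : W →* Cherednik W α c where
  toFun w := of W α c (.w w)
  map_one' := by simpa only [map_one, mk_gen] using Rel.w_one.mk_eq
  map_mul' w w' := by simpa only [map_mul, mk_gen] using (Rel.w_mul w w').mk_eq

theorem mk_gen_x (x : CplxDual E) : mk W α c (gen W (.x x)) = ofX W α c x := rfl

theorem mk_gen_y (y : Cplx E) : mk W α c (gen W (.y y)) = ofY W α c y := rfl

theorem mk_gen_w (w : W) : mk W α c (gen W (.w w)) = ofW W α c w := rfl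

theorem ofW_mul_ofX (w : W) (x : CplxDual E) :
    ofW W α c w * ofX W α c x = ofX W α c (actDual w x) * ofW W α c w := by
  have hconj : ofW W α c w * ofX W α c x * ofW W α c w⁻¹ = ofX W α c (actDual w x) := by
    simpa only [map_mul, mk_gen_w, mk_gen_x] using (Rel.w_x w x).mk_eq
  rw [← hconj, mul_assoc _ (ofW W α c w⁻¹), ← map_mul, inv_mul_cancel, map_one, mul_one]

theorem ofW_mul_ofY (w : W) (y : Cplx E) :
    ofW W α c w * ofY W α c y = ofY W α c (act w y) * ofW W α c w := by
  have hconj : ofW W α c w * ofY W α c y * ofW W α c w⁻¹ = ofY W α c (act w y) := by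
    simpa only [map_mul, mk_gen_w, mk_gen_y] using (Rel.w_y w y).mk_eq
  rw [← hconj, mul_assoc _ (ofW W α c w⁻¹), ← map_mul, inv_mul_cancel, map_one, mul_one]

theorem ofX_mul_ofX_comm (x x' : CplxDual E) :
    ofX W α c x * ofX W α c x' = ofX W α c x' * ofX W α c x := by
  simpa only [map_mul, mk_gen_x] using (Rel.x_comm x x').mk_eq

theorem ofY_mul_ofY_comm (y y' : Cplx E) :
    ofY W α c y * ofY W α c y' = ofY W α c y' * ofY W α c y := by
  simpa only [map_mul, mk_gen_y] using (Rel.y_comm y y').mk_eq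

theorem ofY_mul_ofX_sub [Fintype (reflections W)] (y : Cplx E) (x : CplxDual E) :
    ofY W α c y * ofX W α c x - ofX W α c x * ofY W α c y = algebraMap ℂ _ (x y) +
      ∑ s : reflections W, (c s * rootForm (α s) y * x (coroot (α s))) • ofW W α c s := by
  simpa only [finsum_eq_sum_of_fintype, map_sub, map_mul, map_add, map_sum, AlgHom.commutes,
    map_smul, mk_gen_x, mk_gen_y, mk_gen_w] using (Rel.y_x (α := α) (c := c) y x).mk_eq

theorem adjoin_range_of : Algebra.adjoin ℂ (Set.range (of W α c)) = ⊤ := by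
  have hrange : Set.range (of W α c) = mk W α c '' Set.range (FreeAlgebra.ι ℂ) := by
    rw [← Set.range_comp]
    rfl
  rw [hrange, ← AlgHom.map_adjoin, FreeAlgebra.adjoin_range_ι, Algebra.map_top,
    AlgHom.range_eq_top]
  exact RingQuot.mkAlgHom_surjective ℂ _

theorem adjoin_eq_top_of_span_eq_top {ι κ : Type*} {x : ι → CplxDual E} {y : κ → Cplx E}
    (hx : Submodule.span ℂ (Set.range x) = ⊤) (hy : Submodule.span ℂ (Set.range y) = ⊤) :
    Algebra.adjoin ℂ ((Set.range fun i => ofX W α c (x i)) ∪ (Set.range fun i => ofY W α c (y i)) ∪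
      Set.range (ofW W α c)) = ⊤ := by
  set B := Algebra.adjoin ℂ ((Set.range fun i => ofX W α c (x i)) ∪
    (Set.range fun i => ofY W α c (y i)) ∪ Set.range (ofW W α c))
  have hX : (⊤ : Submodule ℂ (CplxDual E)) ≤ (Subalgebra.toSubmodule B).comap (ofX W α c) := by
    rw [← hx, Submodule.span_le]
    rintro _ ⟨i, rfl⟩
    exact Algebra.subset_adjoin (Or.inl (Or.inl ⟨i, rfl⟩))
  have hY : (⊤ : Submodule ℂ (Cplx E)) ≤ (Subalgebra.toSubmodule B).comap (ofY W α c) := by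
    rw [← hy, Submodule.span_le]
    rintro _ ⟨i, rfl⟩
    exact Algebra.subset_adjoin (Or.inl (Or.inr ⟨i, rfl⟩))
  rw [eq_top_iff, ← adjoin_range_of W α c, Algebra.adjoin_le_iff]
  rintro _ ⟨y | x | w, rfl⟩
  · exact hY Submodule.mem_top
  · exact hX Submodule.mem_top
  · exact Algebra.subset_adjoin (Or.inr ⟨w, rfl⟩)

variable {W α} in
theorem IsRootChoice.inv_eq (hα : IsRootChoice W α) (s : reflections W) : (s : W)⁻¹ = s := by
  apply Subtype.ext
  rw [Subgroup.coe_inv, hα.reflection_eq s]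
  exact Submodule.reflection_symm

variable {ι : Type*} [Fintype ι] [DecidableEq ι] (e : OrthonormalBasis ι ℝ E)
  (hα : IsRootChoice W α)

/-- The reflection datum of a reflection group, in orthonormal coordinates. -/
def datum : ReflectionDatum ℂ ι W (reflections W) where
  mat := (isometryMatrix e).comp W.subtype
  refl s := s
  refl_inv := hα.inv_eq
  root s := coords e (α s)
  scale s := (2 / inner ℝ (α s) (α s) : ℝ)
  param := c
  mat_refl s := (congrArg _ (hα.reflection_eq s)).trans (isometryMatrix_reflection e (α s))
  scale_root s := by
    rw [coords_dotProduct_coords, ← Complex.ofReal_mul,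
      div_mul_cancel₀ _ (inner_self_ne_zero.2 (hα.ne_zero s)), Complex.ofReal_ofNat]

variable [Fintype (reflections W)]

/-- The rational Cherednik algebra in orthonormal coordinates. -/
def cherednikRealization : FullRealization (datum W α c e hα) (Cherednik W α c) where
  x i := ofX W α c (rootForm (e i))
  y i := ofY W α c (1 ⊗ₜ e i)
  w := ofW W α c
  x_comm i j := ofX_mul_ofX_comm W α c _ _
  y_comm i j := ofY_mul_ofY_comm W α c _ _
  w_x g j := by
    rw [ofW_mul_ofX, actDual_rootForm, rootForm_eq_sum e, map_sum, Finset.sum_mul]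
    simp only [map_smul, smul_mul_assoc]
    rfl
  w_y g j := by
    rw [ofW_mul_ofY, act_tmul, one_tmul_eq_sum e, map_sum, Finset.sum_mul]
    simp only [map_smul, smul_mul_assoc]
    rfl
  y_x i j := by
    rw [ofY_mul_ofX_sub]
    congr 1
    · rw [rootForm_tmul, e.inner_eq_ite]
      simp [eq_comm, apply_ite Complex.ofReal]
    · refine Finset.sum_congr rfl fun s _ => congrArg (· • ofW W α c s) ?_
      simp only [datum, coords, coroot, rootForm_tmul, inner_smul_right,
        real_inner_comm (e i) (α s)]
      push_cast
      ring
  adjoin_eq_top :=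
    adjoin_eq_top_of_span_eq_top W α c (span_range_rootForm e) (span_range_one_tmul e)

theorem poly_mem_invX {p : MvPolynomial ι ℂ} (hp : p ∈ (datum W α c e hα).invariants) :
    (cherednikRealization W α c e hα).poly p ∈ invX W α c := by
  refine ⟨?_, (Subalgebra.mem_centralizer_iff ℂ).2 ?_⟩
  · have hadj := (cherednikRealization W α c e hα).poly.mem_range_self p
    rw [FullRealization.range_poly] at hadj
    refine Algebra.adjoin_mono ?_ hadj
    rintro _ ⟨i, rfl⟩
    exact ⟨_, rfl⟩
  · rintro _ ⟨g, rfl⟩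
    have hcomm := (cherednikRealization W α c e hα).w_mul_poly g p
    rwa [hp g] at hcomm

theorem mul_ypoly_of_mem_wSet {p : MvPolynomial ι ℂ} (hp : p ∈ (datum W α c e hα).invariants) :
    ∀ w ∈ wSet W α c, w * (cherednikRealization W α c e hα).ypoly p =
      (cherednikRealization W α c e hα).ypoly p * w := by
  rintro _ ⟨g, rfl⟩
  have hcomm := (cherednikRealization W α c e hα).w_mul_ypoly g p
  rwa [hp g] at hcomm

theorem ypoly_mem_invY {p : MvPolynomial ι ℂ} (hp : p ∈ (datum W α c e hα).invariants) :
    (cherednikRealization W α c e hα).ypoly p ∈ invY W α c := by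
  refine ⟨?_, (Subalgebra.mem_centralizer_iff ℂ).2 (mul_ypoly_of_mem_wSet W α c e hα hp)⟩
  have hadj := (cherednikRealization W α c e hα).ypoly.mem_range_self p
  rw [FullRealization.range_ypoly] at hadj
  refine Algebra.adjoin_mono ?_ hadj
  rintro _ ⟨i, rfl⟩
  exact ⟨_, rfl⟩

theorem ypoly_sub_constantCoeff_mem_adjoin (p : MvPolynomial ι ℂ) :
    (cherednikRealization W α c e hα).ypoly (p - C (constantCoeff p)) ∈
      NonUnitalAlgebra.adjoin ℂ (ySet W α c) := by
  have hy : ∀ i, (cherednikRealization W α c e hα).ypoly (X i) ∈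
      NonUnitalAlgebra.adjoin ℂ (ySet W α c) := fun i => by
    rw [FullRealization.ypoly_X]
    exact NonUnitalAlgebra.subset_adjoin ℂ ⟨_, rfl⟩
  induction p using MvPolynomial.induction_on with
  | C a => simp
  | add p q hp hq =>
    rw [map_add, C_add, add_sub_add_comm, map_add]
    exact add_mem hp hq
  | mul_X p i hp =>
    have hsplit : p * X i - C (constantCoeff (p * X i)) =
        (p - C (constantCoeff p)) * X i + constantCoeff p • X i := by
      rw [map_mul, constantCoeff_X, mul_zero, C_0, smul_eq_C_mul]
      ring
    rw [hsplit, map_add, map_mul, map_smul]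
    exact add_mem (mul_mem hp (hy i)) (SMulMemClass.smul_mem _ (hy i))

theorem ypoly_sub_constantCoeff_mem_Aminus {p : MvPolynomial ι ℂ}
    (hp : p ∈ (datum W α c e hα).invariants) :
    (cherednikRealization W α c e hα).ypoly (p - C (constantCoeff p)) ∈ Aminus W α c :=
  ⟨ypoly_sub_constantCoeff_mem_adjoin W α c e hα p, (NonUnitalSubalgebra.mem_centralizer_iff ℂ).2
    (mul_ypoly_of_mem_wSet W α c e hα (sub_mem hp (Subalgebra.algebraMap_mem _ _)))⟩

end Algebra

section FiniteLength

variable {E : Type*} [NormedAddCommGroup E] [InnerProductSpace ℝ E]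
  {W : Subgroup (E ≃ₗᵢ[ℝ] E)} {α : reflections W → E} {c : reflections W → ℂ}
  {M : Type*} [AddCommGroup M]

theorem IsCategoryO.exists_fg_stable [Module ℂ M] [Module (Cherednik W α c) M]
    [IsScalarTower ℂ (Cherednik W α c) M] (hM : IsCategoryO W α c M) :
    ∃ V : Submodule ℂ M, V.FG ∧ (⊤ : Submodule ℂ (Cherednik W α c)) • V = ⊤ ∧
      ∀ a ∈ Aminus W α c, ∀ v ∈ V, a • v ∈ V := by
  obtain ⟨s, hs⟩ := hM.finite.fg_top
  choose N hfin hmem hstable using hM.locallyFinite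
  refine ⟨⨆ m : s, N m, Submodule.fg_iSup _ fun m =>
    (Submodule.fg_iff_finiteDimensional _).2 (hfin m), top_unique ?_, fun a ha v hv => ?_⟩
  · rw [← top_smul_span_eq_top (𝕜 := ℂ) hs]
    exact Submodule.smul_mono le_rfl (Submodule.span_le.2 fun m hm =>
      Submodule.mem_iSup_of_mem (⟨m, hm⟩ : s) (hmem m))
  · have hle : ⨆ m : s, N m ≤ (⨆ m : s, N m).comap (Algebra.lsmul ℂ ℂ M a) :=
      iSup_le fun m v hv => Submodule.mem_iSup_of_mem m (hstable m a ha v hv)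
    exact hle hv

variable [FiniteDimensional ℝ E] [Finite W]

theorem IsCategoryO.isFiniteLength (hα : IsRootChoice W α) [Module ℂ M]
    [Module (Cherednik W α c) M] [IsScalarTower ℂ (Cherednik W α c) M]
    (hM : IsCategoryO W α c M) : IsFiniteLength (Cherednik W α c) M := by
  have := Fintype.ofFinite (reflections W)
  let e := stdOrthonormalBasis ℝ E
  obtain ⟨V, hV, hgen, hstable⟩ := hM.exists_fg_stable
  refine (cherednikRealization W α c e hα).isFiniteLength_of_stable hV hgen fun p hp v hv => ?_
  have hmem := hstable _ (ypoly_sub_constantCoeff_mem_Aminus W α c e hα hp) v hv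
  rw [map_sub, sub_smul, MvPolynomial.algHom_C, algebraMap_smul] at hmem
  exact (Submodule.sub_mem_iff_left V (V.smul_mem _ hv)).1 hmem

theorem IsHarishChandra.isFiniteLength (hα : IsRootChoice W α) [Module (Env W α c) M]
    (hM : IsHarishChandra W α c M) : IsFiniteLength (Env W α c) M := by
  have := Fintype.ofFinite (reflections W)
  have := hM.finite
  let _ : Module ℂ M := Module.compHom M (algebraMap ℂ (Env W α c))
  have : IsScalarTower ℂ (Env W α c) M :=
    ⟨fun a b m => (congrArg (· • m) (Algebra.smul_def a b)).trans (mul_smul _ b m)⟩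
  let e := stdOrthonormalBasis ℝ E
  exact (cherednikRealization W α c e hα).isFiniteLength_bimodule
    (fun p hp => hM.ad_nilpotent_x _ (poly_mem_invX W α c e hα hp))
    (fun p hp => hM.ad_nilpotent_y _ (ypoly_mem_invY W α c e hα hp))

end FiniteLength

end RationalCherednik

end

theorem mainTheorem10_general {E : Type*} [NormedAddCommGroup E] [InnerProductSpace ℝ E]
    [FiniteDimensional ℝ E] (W : Subgroup (E ≃ₗᵢ[ℝ] E)) [Finite W]
    (α : RationalCherednik.reflections W → E) (hα : RationalCherednik.IsRootChoice W α)
    (c : RationalCherednik.reflections W → ℂ) :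
    (∀ (M : Type*) [AddCommGroup M] [Module ℂ M] [Module (RationalCherednik.Cherednik W α c) M]
        [IsScalarTower ℂ (RationalCherednik.Cherednik W α c) M],
      RationalCherednik.IsCategoryO W α c M →
        IsFiniteLength (RationalCherednik.Cherednik W α c) M) ∧
    (∀ (M : Type*) [AddCommGroup M] [Module (RationalCherednik.Env W α c) M],
      RationalCherednik.IsHarishChandra W α c M →
        IsFiniteLength (RationalCherednik.Env W α c) M) :=
  ⟨fun _ _ _ _ _ hM => hM.isFiniteLength hα, fun _ _ _ hM => hM.isFiniteLength hα⟩

theorem mainTheorem10 {E : Type*} [NormedAddCommGroup E] [InnerProductSpace ℝ E]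
    [FiniteDimensional ℝ E] (W : Subgroup (E ≃ₗᵢ[ℝ] E))
    (hW : RationalCherednik.IsFiniteCoxeter W)
    (α : RationalCherednik.reflections W → E) (hα : RationalCherednik.IsRootChoice W α)
    (c : RationalCherednik.reflections W → ℂ)
    (hc : RationalCherednik.IsInvariantParameter W c) :
    (∀ (M : Type*) [AddCommGroup M] [Module ℂ M] [Module (RationalCherednik.Cherednik W α c) M]
        [IsScalarTower ℂ (RationalCherednik.Cherednik W α c) M],
      RationalCherednik.IsCategoryO W α c M →
        IsFiniteLength (RationalCherednik.Cherednik W α c) M) ∧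
    (∀ (M : Type*) [AddCommGroup M] [Module (RationalCherednik.Env W α c) M],
      RationalCherednik.IsHarishChandra W α c M →
        IsFiniteLength (RationalCherednik.Env W α c) M) :=
  have := hW.finite
  mainTheorem10_general W α hα c
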